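/- Let $1\le N\le N_t$ be integers and let $T>0$, $P_T>0$, $\sigma^2>0$, $\rho=P_T/\sigma^2$. Let $h=(h_1,\dots,h_{N_t})$ be a random vector with i.i.d. circularly symmetric complex Gaussian $\mathcal{CN}(0,1)$ entries (Rayleigh channel of a single-antenna receiver) and let $\varphi_1,\dots,\varphi_N\in\mathbb{C}^{N_t}$ be random precoding vectors, almost surely orthonormal, of arbitrary joint law and independent of $h$. Put $$\mathrm{SINR}_n=\frac{|h^T\varphi_n|^2\,\frac{P_T}{N}}{\sigma^2+\sum_{i\ne n}|h^T\varphi_i|^2\,\frac{P_T}{N}}=\frac{|h^T\varphi_n|^2}{\frac N\rho+\sum_{i\ne n}|h^T\varphi_i|^2},\qquad P=\Pr\Big\{\max_{1\le n\le N}\mathrm{SINR}_n>T\Big\}.$$ (a) If $T\ge 1$, then $P=\dfrac{N}{(T+1)^{N-1}}\,e^{-TN/\rho}$. (b) If $T<1$ and $N\ge 2$, then, with $m=\lceil 1/T\rceil$, $$P=P_1+\sum_{k=2}^{m-1}P_k+P_m .$$ Here $b_k=\dfrac{TN}{\rho(1/k-T)}$ for $1\le k\le m-1$; for $p\ge 2$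 and an expression $g(i,l)$, $$\xi_p(g)=\frac{N}{(N-2)!}\sum_{t=1}^{p}\binom{N-1}{t-1}(-1)^{t+1}\sum_{i=0}^{N-2}\binom{N-2}{i}(1-t)^i\,i!\sum_{l=0}^{i}g(i,l)$$ (with $0^0=1$, and binomial coefficients $\binom{N-1}{t-1}$ equal to $0$ for $t>N$); and $$P_1=\frac{N}{(N-2)!}\left(e^{-TN/\rho}C_1+C_2\right),$$ $$P_k=\xi_k\!\left(e^{-TN/\rho}\frac{T^l}{l!}D_1-\frac{D_2}{(k-1)^l\,l!}\right)+\xi_k\!\left(\frac{E_1}{k^l\,l!}-\frac{E_2}{(k-1)^l\,l!}\right)\quad(2\le k\le m-1),$$ $$P_m=\xi_m\!\left(e^{-TN/\rho}\frac{T^l}{l!}F_1-\frac{F_2}{(m-1)^l\,l!}\right),$$ where $C_1,C_2$ depend on $(N,\rho,T)$, the $D_j,E_j$ also on $(k,i,l)$, the $F_j$ also on $(i,l)$: $$C_1=\frac{(N-2)!}{(T+1)^{N-1}}\Big(1-e^{-(T+1)b_1}\sum_{l=0}^{N-2}\frac{(T+1)^l b_1^l}{l!}\Big),\qquad C_2=\frac{(N-2)!}{2^{N-1}}e^{-2b_1}\sum_{l=0}^{N-2}\frac{2^l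 b_1^l}{l!},$$ $$D_1=\sum_{v=0}^{l}\binom lv\Big(\frac N\rho\Big)^{l-v}\frac{(N-i+v-2)!}{(T+1)^{N-i+v-1}}\sum_{u=0}^{N-i+v-2}\frac{(T+1)^u}{u!}\Big(e^{-(T+1)b_{k-1}}b_{k-1}^u-e^{-(T+1)b_k}b_k^u\Big),$$ $$D_2=\frac{(N-i+l-2)!}{\big(\frac k{k-1}\big)^{N-i+l-1}}\Big[e^{-\frac k{k-1}b_{k-1}}\sum_{u=0}^{N-i+l-2}\Big(\frac k{k-1}\Big)^u\frac{b_{k-1}^u}{u!}-e^{-\frac k{k-1}b_k}\sum_{u=0}^{N-i+l-2}\Big(\frac k{k-1}\Big)^u\frac{b_k^u}{u!}\Big],$$ $$E_1=\frac{(N-i+l-2)!}{\big(\frac{k+1}{k}\big)^{N-i+l-1}}e^{-\frac{k+1}{k}b_k}\sum_{u=0}^{N-i+l-2}\Big(\frac{k+1}{k}\Big)^u\frac{b_k^u}{u!},\qquad E_2=\frac{(N-i+l-2)!}{\big(\frac k{k-1}\big)^{N-i+l-1}}e^{-\frac k{k-1}b_k}\sum_{u=0}^{N-i+l-2}\Big(\frac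 k{k-1}\Big)^u\frac{b_k^u}{u!},$$ $$F_1=\sum_{v=0}^{l}\binom lv\Big(\frac N\rho\Big)^{l-v}\frac{(N-i+v-2)!}{(T+1)^{N-i+v-1}}e^{-(T+1)b_{m-1}}\sum_{u=0}^{N-i+v-2}(T+1)^u\frac{b_{m-1}^u}{u!},$$ $$F_2=\frac{(N-i+l-2)!}{\big(\frac m{m-1}\big)^{N-i+l-1}}e^{-\frac m{m-1}b_{m-1}}\sum_{u=0}^{N-i+l-2}\Big(\frac m{m-1}\Big)^u\frac{b_{m-1}^u}{u!}.$$ -/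

import Mathlib

open MeasureTheory ProbabilityTheory
open scoped NNReal Nat

noncomputable section

namespace ORP

/-! ### The system model -/

/-- The circularly symmetric complex Gaussian law `CN(0, v)`: real and imaginary part are
independent real centred Gaussians, each of variance `v / 2`. -/
def circGaussian (v : ℝ≥0) : Measure ℂ :=
  ((gaussianReal 0 (v / 2)).prod (gaussianReal 0 (v / 2))).map
    (fun p : ℝ × ℝ => (⟨p.1, p.2⟩ : ℂ))

/-- Rayleigh fading channel vector of a single-antenna receiver: the coefficients are i.i.d.
with law `CN(0, 1)`. -/
def IsRayleighChannel {Ω : Type*} [MeasurableSpace Ω] (P : Measure Ω) {Nt : ℕ}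
    (h : Ω → Fin Nt → ℂ) : Prop :=
  (∀ j, HasLaw (fun ω => h ω j) (circGaussian 1) P) ∧ iIndepFun (fun j ω => h ω j) P

/-- A random precoder: `Φ ω n` is the `n`-th precoding vector in `ℂ ^ Nt`. It is a random
variable whose `N` precoding vectors are almost surely orthonormal; its law is arbitrary
otherwise. -/
def IsOrthonormalPrecoder {Ω : Type*} [MeasurableSpace Ω] (P : Measure Ω) {Nt N : ℕ}
    (Φ : Ω → Fin N → EuclideanSpace ℂ (Fin Nt)) : Prop :=
  AEMeasurable Φ P ∧ ∀ᵐ ω ∂P, Orthonormal ℂ (Φ ω)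

/-- The effective channel `hᵀ w` of the beam `w` (no complex conjugation). -/
def beamGain {Nt : ℕ} (h : Fin Nt → ℂ) (w : EuclideanSpace ℂ (Fin Nt)) : ℂ :=
  ∑ j, h j * w j

/-- The SINR of the `n`-th beam: total transmit power `PT`, split evenly over the `N` beams,
and noise variance `σ2`; the other beams are interference. -/
def sinr {Nt N : ℕ} (PT σ2 : ℝ) (h : Fin Nt → ℂ) (w : Fin N → EuclideanSpace ℂ (Fin Nt))
    (n : Fin N) : ℝ :=
  (‖beamGain h (w n)‖ ^ 2 * (PT / N)) /
    (σ2 + ∑ i ∈ Finset.univ.erase n, ‖beamGain h (w i)‖ ^ 2 * (PT / N))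

/-- The downlink coverage probability: the probability that the largest of the `N` SINRs
exceeds the threshold `T`. -/
def coverageProb {Ω : Type*} [MeasurableSpace Ω] (P : Measure Ω) {Nt N : ℕ} (PT σ2 T : ℝ)
    (h : Ω → Fin Nt → ℂ) (Φ : Ω → Fin N → EuclideanSpace ℂ (Fin Nt)) : ℝ :=
  P.real {ω | T < ⨆ n : Fin N, sinr PT σ2 (h ω) (Φ ω) n}

/-! ### The closed form for `T < 1`

Below `N` is the number of beams (`N ≥ 2`), `ρ` the average SNR and `T` the threshold. All
natural-number subtractions are exact in the ranges in which they are used (`i ≤ N - 2`). -/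

/-- `b_k = T N / (ρ (1/k - T))`. -/
def bpt (N : ℕ) (ρ T : ℝ) (k : ℕ) : ℝ := T * N / (ρ * (1 / (k : ℝ) - T))

/-- The number `m = ⌈1 / T⌉`. -/
def mIdx (T : ℝ) : ℕ := ⌈1 / T⌉₊

/-- The operator `ξ_p`, applied to an expression `g i l` in the two inner indices. -/
def xi (N p : ℕ) (g : ℕ → ℕ → ℝ) : ℝ :=
  N / ((N - 2)! : ℝ) * ∑ t ∈ Finset.Icc 1 p, ((N - 1).choose (t - 1) : ℝ) * (-1) ^ (t + 1) *
    ∑ i ∈ Finset.range (N - 2 + 1), ((N - 2).choose i : ℝ) * (1 - (t : ℝ)) ^ i * (i ! : ℝ) *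
      ∑ l ∈ Finset.range (i + 1), g i l

def C1 (N : ℕ) (ρ T : ℝ) : ℝ :=
  ((N - 2)! : ℝ) / (T + 1) ^ (N - 1) *
    (1 - Real.exp (-(T + 1) * bpt N ρ T 1) *
      ∑ l ∈ Finset.range (N - 2 + 1), (T + 1) ^ l * bpt N ρ T 1 ^ l / (l ! : ℝ))

def C2 (N : ℕ) (ρ T : ℝ) : ℝ :=
  ((N - 2)! : ℝ) / 2 ^ (N - 1) * Real.exp (-2 * bpt N ρ T 1) *
    ∑ l ∈ Finset.range (N - 2 + 1), 2 ^ l * bpt N ρ T 1 ^ l / (l ! : ℝ)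

def D1 (N : ℕ) (ρ T : ℝ) (k i l : ℕ) : ℝ :=
  ∑ v ∈ Finset.range (l + 1), (l.choose v : ℝ) * (N / ρ) ^ (l - v) *
    (((N - i + v - 2)! : ℝ) / (T + 1) ^ (N - i + v - 1)) *
    ∑ u ∈ Finset.range (N - i + v - 2 + 1), (T + 1) ^ u / (u ! : ℝ) *
      (Real.exp (-(T + 1) * bpt N ρ T (k - 1)) * bpt N ρ T (k - 1) ^ u -
        Real.exp (-(T + 1) * bpt N ρ T k) * bpt N ρ T k ^ u)

def D2 (N : ℕ) (ρ T : ℝ) (k i l : ℕ) : ℝ :=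
  ((N - i + l - 2)! : ℝ) / ((k : ℝ) / (k - 1)) ^ (N - i + l - 1) *
    (Real.exp (-((k : ℝ) / (k - 1)) * bpt N ρ T (k - 1)) *
        ∑ u ∈ Finset.range (N - i + l - 2 + 1),
          ((k : ℝ) / (k - 1)) ^ u * (bpt N ρ T (k - 1) ^ u / (u ! : ℝ)) -
      Real.exp (-((k : ℝ) / (k - 1)) * bpt N ρ T k) *
        ∑ u ∈ Finset.range (N - i + l - 2 + 1),
          ((k : ℝ) / (k - 1)) ^ u * (bpt N ρ T k ^ u / (u ! : ℝ)))

def E1 (N : ℕ) (ρ T : ℝ) (k i l : ℕ) : ℝ :=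
  ((N - i + l - 2)! : ℝ) / (((k : ℝ) + 1) / k) ^ (N - i + l - 1) *
    Real.exp (-(((k : ℝ) + 1) / k) * bpt N ρ T k) *
    ∑ u ∈ Finset.range (N - i + l - 2 + 1),
      (((k : ℝ) + 1) / k) ^ u * (bpt N ρ T k ^ u / (u ! : ℝ))

def E2 (N : ℕ) (ρ T : ℝ) (k i l : ℕ) : ℝ :=
  ((N - i + l - 2)! : ℝ) / ((k : ℝ) / (k - 1)) ^ (N - i + l - 1) *
    Real.exp (-((k : ℝ) / (k - 1)) * bpt N ρ T k) *
    ∑ u ∈ Finset.range (N - i + l - 2 + 1),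
      ((k : ℝ) / (k - 1)) ^ u * (bpt N ρ T k ^ u / (u ! : ℝ))

def F1 (N : ℕ) (ρ T : ℝ) (m i l : ℕ) : ℝ :=
  ∑ v ∈ Finset.range (l + 1), (l.choose v : ℝ) * (N / ρ) ^ (l - v) *
    (((N - i + v - 2)! : ℝ) / (T + 1) ^ (N - i + v - 1)) *
    Real.exp (-(T + 1) * bpt N ρ T (m - 1)) *
    ∑ u ∈ Finset.range (N - i + v - 2 + 1),
      (T + 1) ^ u * (bpt N ρ T (m - 1) ^ u / (u ! : ℝ))

def F2 (N : ℕ) (ρ T : ℝ) (m i l : ℕ) : ℝ :=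
  ((N - i + l - 2)! : ℝ) / ((m : ℝ) / (m - 1)) ^ (N - i + l - 1) *
    Real.exp (-((m : ℝ) / (m - 1)) * bpt N ρ T (m - 1)) *
    ∑ u ∈ Finset.range (N - i + l - 2 + 1),
      ((m : ℝ) / (m - 1)) ^ u * (bpt N ρ T (m - 1) ^ u / (u ! : ℝ))

/-- The first term `P_1`. -/
def Pfirst (N : ℕ) (ρ T : ℝ) : ℝ :=
  N / ((N - 2)! : ℝ) * (Real.exp (-(T * N / ρ)) * C1 N ρ T + C2 N ρ T)

/-- The middle terms `P_k`, `2 ≤ k ≤ m - 1`. -/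
def Pmid (N : ℕ) (ρ T : ℝ) (k : ℕ) : ℝ :=
  xi N k (fun i l => Real.exp (-(T * N / ρ)) * (T ^ l / (l ! : ℝ)) * D1 N ρ T k i l -
      1 / (((k : ℝ) - 1) ^ l * (l ! : ℝ)) * D2 N ρ T k i l) +
    xi N k (fun i l => 1 / ((k : ℝ) ^ l * (l ! : ℝ)) * E1 N ρ T k i l -
      1 / (((k : ℝ) - 1) ^ l * (l ! : ℝ)) * E2 N ρ T k i l)

/-- The last term `P_m`, to be used at `m = ⌈1 / T⌉`. -/
def Plast (N : ℕ) (ρ T : ℝ) (m : ℕ) : ℝ :=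
  xi N m (fun i l => Real.exp (-(T * N / ρ)) * (T ^ l / (l ! : ℝ)) * F1 N ρ T m i l -
      1 / (((m : ℝ) - 1) ^ l * (l ! : ℝ)) * F2 N ρ T m i l)

end ORP

end

/-!
Condition on the precoder. For orthonormal beams the effective channels `hᵀ w_n` are again i.i.d.
`CN(0, 1)` (`map_beamGain_pi_circGaussian`, by characteristic functions), so the beam powers
`x_n = |hᵀ w_n|²` are i.i.d. standard exponential variables (`map_norm_sq_circGaussian`, by polar
coordinates), whatever the precoder. With `c = N / ρ`, beam `n` is covered iff
`T (c + ∑_{i ≠ n} x_i) < x_n`, and if any beam is covered then so is the strongest one. Ties have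
probability zero, so by symmetry the coverage probability is `N` times the probability that a given
beam is covered and dominates all the others (`real_exists_covered`).

For `T ≥ 1` a covered beam dominates automatically, and integrating its power out first leaves
the Laplace transform of `N - 1` independent exponential variables (`real_covered_of_one_le`).

For `T < 1` let `y` be the power of the dominating beam and `z` the total interference. On the
event that all interferers are below `y`, the law of `z` has density
`e^{-z} truncDensity (N - 2) y z`, an alternating sum of truncated powers `(z - t y)₊^{N - 2}`
(`real_truncSum`, by induction on the number of interferers: convolving a truncated power with the
indicator of `[0, y]` gives a difference of two of the next degree, and Pascal's rule collects
them). By Fubini, the probability is an integral over `z > 0`, `y > T (c + z)`. This region is cut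
into the cones `z / p < y ≤ z / (p - 1)`. On the `p`-th cone exactly the first `p` terms of the
density survive, which is the operator `xi N p`; the line `y = T (c + z)` crosses the ray
`y = z / k` at `z = b_k = bpt N ρ T k`; and all cones beyond `m = ⌈1 / T⌉` miss the region. What
remains are incomplete gamma integrals (`gammaTail`), first in `y` and then in `z`. The cones
`p = 1`, `1 < p < m` and `p = m` give `Pfirst`, `Pmid` and `Plast` (`setIntegral_first`,
`setIntegral_mid`, `setIntegral_last`).
-/

namespace ORP

/-! ### Unitary invariance of the Rayleigh channel -/

lemma measurable_complex_mk : Measurable fun p : ℝ × ℝ => (⟨p.1, p.2⟩ : ℂ) :=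
  Complex.measurableEquivRealProd.symm.measurable

instance isProbabilityMeasure_circGaussian (v : ℝ≥0) : IsProbabilityMeasure (circGaussian v) :=
  Measure.isProbabilityMeasure_map measurable_complex_mk.aemeasurable

lemma charFun_circGaussian (v : ℝ≥0) (t : ℂ) :
    charFun (circGaussian v) t = Complex.exp (-(v * ‖t‖ ^ 2 / 4 : ℝ)) := by
  have h1 := charFun_gaussianReal (μ := 0) (v := v / 2) t.re
  have h2 := charFun_gaussianReal (μ := 0) (v := v / 2) t.im
  rw [charFun_apply_real] at h1 h2
  rw [charFun_apply, circGaussian, integral_map measurable_complex_mk.aemeasurable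
    (by fun_prop)]
  have : ∀ p : ℝ × ℝ, Complex.exp ((inner ℝ (⟨p.1, p.2⟩ : ℂ) t : ℝ) * Complex.I)
      = Complex.exp (t.re * p.1 * Complex.I) * Complex.exp (t.im * p.2 * Complex.I) := by
    intro p
    rw [← Complex.exp_add, Complex.inner]
    congr 1
    simp
    ring
  simp_rw [this]
  rw [integral_prod_mul (fun x : ℝ => Complex.exp (t.re * x * Complex.I))
    (fun x : ℝ => Complex.exp (t.im * x * Complex.I)), h1, h2, ← Complex.exp_add,
    Complex.sq_norm, Complex.normSq_apply]
  congr 1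
  push_cast
  ring

/-- `(h ᵀ w_n)_n`, for orthonormal beams `w_n`, is again a vector of independent complex
Gaussians. -/
lemma map_beamGain_pi_circGaussian {Nt N : ℕ} (v : ℝ≥0)
    {w : Fin N → EuclideanSpace ℂ (Fin Nt)} (hw : Orthonormal ℂ w) :
    (Measure.pi fun _ : Fin Nt => circGaussian v).map (fun h n => beamGain h (w n)) =
      Measure.pi fun _ : Fin N => circGaussian v := by
  have hmeas : Measurable fun (h : Fin Nt → ℂ) (n : Fin N) => beamGain h (w n) := by
    unfold beamGain; fun_prop
  have := Measure.isProbabilityMeasure_map (μ := Measure.pi fun _ : Fin Nt => circGaussian v)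
    hmeas.aemeasurable
  apply (MeasurableEquiv.toLp 2 (Fin N → ℂ)).map_measurableEquiv_injective
  have i1 := Measure.isProbabilityMeasure_map (μ := (Measure.pi fun _ : Fin Nt =>
    circGaussian v).map (fun h n => beamGain h (w n)))
    (MeasurableEquiv.toLp 2 (Fin N → ℂ)).measurable.aemeasurable
  have i2 := Measure.isProbabilityMeasure_map (μ := Measure.pi fun _ : Fin N => circGaussian v)
    (MeasurableEquiv.toLp 2 (Fin N → ℂ)).measurable.aemeasurable
  refine Measure.ext_of_charFun (E := PiLp 2 fun _ : Fin N => ℂ) (funext fun t => ?_)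
  -- The adjoint of the map `h ↦ (hᵀ w_n)_n` sends `t` to the vector `s`.
  let s : Fin Nt → ℂ := fun j => ∑ n, (starRingEnd ℂ) (w n j) * t n
  -- Orthonormality says that this adjoint is an isometry.
  have hs : ∑ j, ‖s j‖ ^ 2 = ∑ n, ‖t n‖ ^ 2 := by
    have h1 := hw.inner_sum (fun n => (starRingEnd ℂ) (t n)) (fun n => (starRingEnd ℂ) (t n))
      Finset.univ
    have h2 : ∀ z : ℂ, (z * (starRingEnd ℂ) z : ℂ) = ((‖z‖ ^ 2 : ℝ) : ℂ) := by
      intro z; rw [Complex.mul_conj, Complex.normSq_eq_norm_sq]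
    simp only [RingHomCompTriple.comp_apply, RingHom.id_apply, h2] at h1
    rw [inner_self_eq_norm_sq_to_K] at h1
    have h3 : ‖∑ n, (starRingEnd ℂ) (t n) • w n‖ ^ 2 = ∑ n, ‖t n‖ ^ 2 := by
      apply Complex.ofReal_injective
      rw [Complex.ofReal_sum, ← h1]
      exact Complex.ofReal_pow _ _
    rw [← h3, EuclideanSpace.norm_sq_eq]
    refine Finset.sum_congr rfl fun j _ => ?_
    rw [← Complex.norm_conj (s j)]
    simp [s, mul_comm]
  have key : charFun (((Measure.pi fun _ : Fin Nt => circGaussian v).map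
      (fun h n => beamGain h (w n))).map (WithLp.toLp 2)) t =
      charFun ((Measure.pi fun _ : Fin Nt => circGaussian v).map (WithLp.toLp 2))
        (WithLp.toLp 2 s : PiLp 2 fun _ : Fin Nt => ℂ) := by
    rw [charFun_apply, charFun_apply, ← MeasurableEquiv.coe_toLp, integral_map_equiv,
      ← MeasurableEquiv.coe_toLp, integral_map_equiv, integral_map hmeas.aemeasurable]
    · refine integral_congr_ae (Filter.Eventually.of_forall fun h => ?_)
      simp only [MeasurableEquiv.coe_toLp, PiLp.inner_apply]
      congr 3
      simp only [Complex.inner, beamGain, s]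
      simp only [← Complex.re_sum]
      congr 1
      simp only [map_sum, map_mul, Finset.mul_sum, Finset.sum_mul]
      rw [Finset.sum_comm]
      refine Finset.sum_congr rfl fun j _ => Finset.sum_congr rfl fun n _ => ?_
      ring
    · have : Measurable fun x : Fin N → ℂ => (inner ℝ
        ((MeasurableEquiv.toLp 2 (Fin N → ℂ)) x : PiLp 2 fun _ : Fin N => ℂ) t : ℝ) := by
        simp only [MeasurableEquiv.coe_toLp, PiLp.inner_apply, Complex.inner]
        fun_prop
      exact (by fun_prop : Measurable _).aestronglyMeasurable
  simp only [MeasurableEquiv.coe_toLp]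
  rw [key, charFun_pi, charFun_pi]
  simp only [charFun_circGaussian, ← Complex.exp_sum]
  congr 1
  norm_cast
  simp only [Finset.sum_neg_distrib, ← Finset.sum_div, ← Finset.mul_sum]
  rw [hs]

lemma measurable_beamGain_prod {Nt N : ℕ} (n : Fin N) :
    Measurable fun p : (Fin Nt → ℂ) × (Fin N → EuclideanSpace ℂ (Fin Nt)) =>
      beamGain p.1 (p.2 n) := by
  unfold beamGain
  fun_prop

/-! ### The beam powers are exponential -/

lemma expMeasure_one_eq :
    expMeasure 1 = (volume.restrict (Set.Ioi 0)).withDensity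
      (fun x : ℝ => ENNReal.ofReal (Real.exp (-x))) := by
  rw [expMeasure, gammaMeasure, Measure.restrict_congr_set Ioi_ae_eq_Ici,
    ← withDensity_indicator measurableSet_Ici]
  congr 1
  ext x
  by_cases hx : 0 ≤ x
  · rw [Set.indicator_of_mem (Set.mem_Ici.2 hx), gammaPDF_of_nonneg hx]
    simp
  · rw [Set.indicator_of_notMem (by simpa using hx), gammaPDF_of_neg (not_le.1 hx)]

/-- The squared modulus of a `CN(0, 1)` variable is exponentially distributed. -/
lemma map_norm_sq_circGaussian :
    (circGaussian 1).map (fun z => ‖z‖ ^ 2) = expMeasure 1 := by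
  have hm : Measurable fun z : ℂ => ‖z‖ ^ 2 := by fun_prop
  ext s hs
  have hA := measurable_complex_mk (hm hs)
  rw [Measure.map_apply hm hs, circGaussian, Measure.map_apply measurable_complex_mk (hm hs),
    expMeasure_one_eq, withDensity_apply _ hs, ← lintegral_indicator hs]
  have hv : (1 / 2 : ℝ≥0) ≠ 0 := by norm_num
  rw [gaussianReal_of_var_ne_zero _ hv, prod_withDensity (by fun_prop) (by fun_prop),
    withDensity_apply _ hA, ← lintegral_indicator hA, ← Measure.volume_eq_prod,
    ← lintegral_comp_polarCoord_symm]
  -- In polar coordinates the integrand does not depend on the angle.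
  let F : ℝ → ENNReal := fun r => ENNReal.ofReal r * s.indicator
    (fun u => ENNReal.ofReal (Real.pi⁻¹ * Real.exp (-u))) (r ^ 2)
  have hF : Measurable F := by
    have : Measurable (s.indicator
      (fun u : ℝ => ENNReal.ofReal (Real.pi⁻¹ * Real.exp (-u)))) :=
      Measurable.indicator (by fun_prop) hs
    exact Measurable.mul (by fun_prop) (this.comp (by fun_prop))
  have h1 : ∀ p : ℝ × ℝ, ENNReal.ofReal p.1 • Set.indicator
      ((fun p : ℝ × ℝ => (⟨p.1, p.2⟩ : ℂ)) ⁻¹' ((fun z : ℂ => ‖z‖ ^ 2) ⁻¹' s))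
      (fun z : ℝ × ℝ => gaussianPDF 0 (1 / 2) z.1 * gaussianPDF 0 (1 / 2) z.2)
      (polarCoord.symm p) = F p.1 := by
    intro p
    have hn : ‖(⟨p.1 * Real.cos p.2, p.1 * Real.sin p.2⟩ : ℂ)‖ ^ 2 = p.1 ^ 2 := by
      rw [Complex.sq_norm, Complex.normSq_mk]
      linear_combination p.1 ^ 2 * Real.cos_sq_add_sin_sq p.2
    simp only [F, polarCoord_symm_apply, smul_eq_mul]
    congr 1
    by_cases h : p.1 ^ 2 ∈ s
    · rw [Set.indicator_of_mem h, Set.indicator_of_mem (by simpa [hn] using h), gaussianPDF,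
        gaussianPDF, ← ENNReal.ofReal_mul (gaussianPDFReal_nonneg _ _ _), gaussianPDFReal,
        gaussianPDFReal]
      congr 1
      have h2 : (√(2 * Real.pi * ((1 / 2 : ℝ≥0) : ℝ)))⁻¹ * (√(2 * Real.pi * ((1 / 2 : ℝ≥0) : ℝ)))⁻¹
          = Real.pi⁻¹ := by
        rw [← mul_inv, Real.mul_self_sqrt (by positivity)]
        congr 1
        push_cast
        ring
      rw [mul_mul_mul_comm, h2, ← Real.exp_add]
      congr 2
      push_cast
      linear_combination -p.1 ^ 2 * Real.cos_sq_add_sin_sq p.2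
    · rw [Set.indicator_of_notMem h, Set.indicator_of_notMem (by simpa [hn] using h)]
  simp_rw [h1]
  rw [polarCoord_target, Measure.volume_eq_prod, ← Measure.prod_restrict,
    lintegral_prod _ (by fun_prop)]
  have hsq : (fun r : ℝ => r ^ 2) '' Set.Ioi 0 = Set.Ioi 0 := by
    ext u
    constructor
    · rintro ⟨r, hr, rfl⟩
      exact pow_pos (Set.mem_Ioi.1 hr) 2
    · intro hu
      exact ⟨√u, Real.sqrt_pos.2 hu, Real.sq_sqrt (le_of_lt hu)⟩
  -- Substitute `u = r ^ 2` on the right.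
  conv_rhs => rw [← hsq]
  rw [lintegral_image_eq_lintegral_abs_deriv_mul (f' := fun r => 2 * r) measurableSet_Ioi
    (fun x _ => by simpa using (hasDerivAt_pow 2 x).hasDerivWithinAt)
    (fun a ha b hb hab => by
      exact (sq_eq_sq₀ (le_of_lt ha) (le_of_lt hb)).1 hab)]
  refine setLIntegral_congr_fun measurableSet_Ioi fun r hr => ?_
  have hr' : (0 : ℝ) < r := hr
  simp only [lintegral_const, Measure.restrict_apply_univ, Real.volume_Ioo, F]
  by_cases h : r ^ 2 ∈ s
  · rw [Set.indicator_of_mem h, Set.indicator_of_mem h, abs_of_pos (by positivity),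
      ← ENNReal.ofReal_mul (by positivity), ← ENNReal.ofReal_mul (by positivity),
      ← ENNReal.ofReal_mul (by positivity)]
    congr 1
    field_simp
    ring
  · rw [Set.indicator_of_notMem h, Set.indicator_of_notMem h]
    simp

instance : IsProbabilityMeasure (expMeasure 1) := isProbabilityMeasure_expMeasure one_pos

lemma map_beamGain_sq {Nt N : ℕ} {w : Fin N → EuclideanSpace ℂ (Fin Nt)}
    (hw : Orthonormal ℂ w) :
    (Measure.pi fun _ : Fin Nt => circGaussian 1).map (fun h n => ‖beamGain h (w n)‖ ^ 2) =
      Measure.pi fun _ : Fin N => expMeasure 1 := by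
  have hmeas : Measurable fun (h : Fin Nt → ℂ) (n : Fin N) => beamGain h (w n) := by
    unfold beamGain; fun_prop
  have : (fun (h : Fin Nt → ℂ) (n : Fin N) => ‖beamGain h (w n)‖ ^ 2) =
      (fun (z : Fin N → ℂ) n => ‖z n‖ ^ 2) ∘ fun h n => beamGain h (w n) := rfl
  rw [this, ← Measure.map_map (by fun_prop) hmeas, map_beamGain_pi_circGaussian 1 hw]
  have hp := Measure.pi_map_pi (μ := fun _ : Fin N => circGaussian 1)
    (f := fun _ (z : ℂ) => ‖z‖ ^ 2)
    (hμ := fun _ => by rw [map_norm_sq_circGaussian]; infer_instance)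
    (fun _ => by fun_prop)
  rw [hp]
  simp only [map_norm_sq_circGaussian]

lemma measurableSet_orthonormal {Nt N : ℕ} :
    MeasurableSet {w : Fin N → EuclideanSpace ℂ (Fin Nt) | Orthonormal ℂ w} := by
  have : {w : Fin N → EuclideanSpace ℂ (Fin Nt) | Orthonormal ℂ w} =
      ⋂ i, ⋂ j, {w | inner ℂ (w i) (w j) = if i = j then (1 : ℂ) else 0} := by
    ext w
    simp [orthonormal_iff_ite]
  rw [this]
  exact MeasurableSet.iInter fun i => MeasurableSet.iInter fun j =>
    measurableSet_eq_fun (by fun_prop) measurable_const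

/-- The coverage probability only depends on the powers `x n` of the `N` beams at the receiver,
and these are independent exponential variables whatever the precoder. -/
lemma coverageProb_eq {Ω : Type*} [MeasurableSpace Ω] (P : Measure Ω) [IsProbabilityMeasure P]
    {Nt N : ℕ} (hN : 1 ≤ N) {PT σ2 T : ℝ} (hPT : 0 < PT) (hσ2 : 0 < σ2)
    {h : Ω → Fin Nt → ℂ} {Φ : Ω → Fin N → EuclideanSpace ℂ (Fin Nt)}
    (hh : IsRayleighChannel P h) (hΦ : IsOrthonormalPrecoder P Φ) (hind : IndepFun h Φ P) :
    coverageProb P PT σ2 T h Φ = (Measure.pi fun _ : Fin N => expMeasure 1).real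
      {x | ∃ n, T * (N / (PT / σ2) + ∑ i ∈ Finset.univ.erase n, x i) < x n} := by
  have hNpos : (0 : ℝ) < N := by exact_mod_cast hN
  have : Nonempty (Fin N) := ⟨⟨0, hN⟩⟩
  have hlaw : P.map h = Measure.pi fun _ : Fin Nt => circGaussian 1 :=
    (hh.2.hasLaw_pi hh.1).map_eq
  have hhm : AEMeasurable h P := (hh.2.hasLaw_pi hh.1).aemeasurable
  set A : Set (Fin N → ℝ) :=
    {x | ∃ n, T * (N / (PT / σ2) + ∑ i ∈ Finset.univ.erase n, x i) < x n} with hA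
  have hAm : MeasurableSet A := by
    have : A = ⋃ n, {x | T * (N / (PT / σ2) + ∑ i ∈ Finset.univ.erase n, x i) < x n} := by
      ext x; simp [hA]
    rw [this]
    exact MeasurableSet.iUnion fun n => measurableSet_lt (by fun_prop) (by fun_prop)
  let G : (Fin Nt → ℂ) × (Fin N → EuclideanSpace ℂ (Fin Nt)) → Fin N → ℝ :=
    fun p n => ‖beamGain p.1 (p.2 n)‖ ^ 2
  have hG : Measurable G := measurable_pi_lambda _ fun n =>
    (measurable_beamGain_prod n).norm.pow_const 2
  have hset : {ω | T < ⨆ n : Fin N, sinr PT σ2 (h ω) (Φ ω) n} =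
      (fun ω => (h ω, Φ ω)) ⁻¹' (G ⁻¹' A) := by
    ext ω
    have hb : BddAbove (Set.range (sinr PT σ2 (h ω) (Φ ω))) := (Set.finite_range _).bddAbove
    simp only [Set.mem_ofPred_eq, Set.mem_preimage, hA, G, lt_ciSup_iff hb]
    refine exists_congr fun n => ?_
    have hs : 0 ≤ ∑ i ∈ Finset.univ.erase n, ‖beamGain (h ω) (Φ ω i)‖ ^ 2 := by positivity
    rw [sinr, ← Finset.sum_mul, lt_div_iff₀ (by positivity)]
    have e : T * (σ2 + (∑ i ∈ Finset.univ.erase n, ‖beamGain (h ω) (Φ ω i)‖ ^ 2) * (PT / N)) =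
      (T * (N / (PT / σ2) + ∑ i ∈ Finset.univ.erase n, ‖beamGain (h ω) (Φ ω i)‖ ^ 2)) *
        (PT / N) := by
      field_simp
    rw [e]
    exact mul_lt_mul_iff_left₀ (by positivity)
  rw [coverageProb, hset, Measure.real, Measure.real]
  congr 1
  have := Measure.isProbabilityMeasure_map (μ := P) hΦ.1
  rw [← Measure.map_apply_of_aemeasurable (hhm.prodMk hΦ.1) (hG hAm),
    (indepFun_iff_map_prod_eq_prod_map_map hhm hΦ.1).1 hind, hlaw,
    Measure.prod_apply_symm (hG hAm)]
  have hort : ∀ᵐ w ∂(P.map Φ), Orthonormal ℂ w :=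
    (ae_map_iff hΦ.1 measurableSet_orthonormal).2 hΦ.2
  have : ∀ᵐ w ∂(P.map Φ), (Measure.pi fun _ : Fin Nt => circGaussian 1)
      ((fun x => (x, w)) ⁻¹' (G ⁻¹' A)) = (Measure.pi fun _ : Fin N => expMeasure 1) A := by
    filter_upwards [hort] with w hw
    rw [← map_beamGain_sq hw, Measure.map_apply (by unfold beamGain; fun_prop) hAm]
    rfl
  rw [lintegral_congr_ae this]
  simp

/-! ### The strongest beam -/

instance : NullSingletonClass (expMeasure 1) := by
  rw [expMeasure_one_eq]; infer_instance

lemma integral_expMeasure_one (f : ℝ → ℝ) :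
    ∫ x, f x ∂(expMeasure 1) = ∫ x in Set.Ioi 0, Real.exp (-x) * f x := by
  rw [expMeasure_one_eq, integral_withDensity_eq_integral_toReal_smul (by fun_prop)
    (Filter.Eventually.of_forall fun _ => ENNReal.ofReal_lt_top)]
  simp [ENNReal.toReal_ofReal (Real.exp_nonneg _)]

lemma ae_pos_expMeasure_one : ∀ᵐ x ∂(expMeasure 1), 0 < x := by
  rw [expMeasure_one_eq]
  exact (withDensity_absolutelyContinuous _ _).ae_le (ae_restrict_mem measurableSet_Ioi)

lemma ae_pos_pi_expMeasure_one (M : ℕ) :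
    ∀ᵐ x ∂(Measure.pi fun _ : Fin M => expMeasure 1), ∀ i, 0 < x i :=
  ae_all_iff.2 fun i => (Measure.quasiMeasurePreserving_eval
    (fun _ : Fin M => expMeasure 1) i).ae ae_pos_expMeasure_one

lemma real_prod_apply_symm {α β : Type*} [MeasurableSpace α] [MeasurableSpace β]
    (μ : Measure α) (ν : Measure β) [IsProbabilityMeasure μ] [IsProbabilityMeasure ν]
    {s : Set (α × β)} (hs : MeasurableSet s) :
    (μ.prod ν).real s = ∫ y, μ.real ((fun x => (x, y)) ⁻¹' s) ∂ν := by
  rw [Measure.real, Measure.prod_apply_symm hs, ← integral_toReal]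
  · rfl
  · exact (measurable_measure_prodMk_right hs).aemeasurable
  · exact Filter.Eventually.of_forall fun y => measure_lt_top _ _

lemma real_prod_apply {α β : Type*} [MeasurableSpace α] [MeasurableSpace β]
    (μ : Measure α) (ν : Measure β) [IsProbabilityMeasure μ] [IsProbabilityMeasure ν]
    {s : Set (α × β)} (hs : MeasurableSet s) :
    (μ.prod ν).real s = ∫ x, ν.real (Prod.mk x ⁻¹' s) ∂μ := by
  rw [Measure.real, Measure.prod_apply hs, ← integral_toReal]
  · rfl
  · exact (measurable_measure_prodMk_left hs).aemeasurable
  · exact Filter.Eventually.of_forall fun y => measure_lt_top _ _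

lemma expMeasure_one_real_Ioi {a : ℝ} (ha : 0 ≤ a) :
    (expMeasure 1).real (Set.Ioi a) = Real.exp (-a) := by
  rw [← integral_indicator_one measurableSet_Ioi, integral_expMeasure_one]
  have : ∀ x : ℝ, Real.exp (-x) * (Set.Ioi a).indicator 1 x =
      (Set.Ioi a).indicator (fun x => Real.exp (-x)) x := by
    intro x
    by_cases hx : x ∈ Set.Ioi a <;> simp [hx]
  simp_rw [this]
  rw [setIntegral_indicator measurableSet_Ioi, Set.Ioi_inter_Ioi, sup_eq_right.2 ha,
    integral_exp_neg_Ioi]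

/-- Ties between independent exponential variables have probability zero. -/
lemma ae_injective_pi_expMeasure_one (M : ℕ) :
    ∀ᵐ x ∂(Measure.pi fun _ : Fin (M + 1) => expMeasure 1), ∀ i j, i ≠ j → x i ≠ x j := by
  refine ae_all_iff.2 fun i => ae_all_iff.2 fun j => ?_
  by_cases hij : i = j
  · simp [hij]
  obtain ⟨k, rfl⟩ := Fin.exists_succAbove_eq (Ne.symm hij)
  have hmp := measurePreserving_piFinSuccAbove (fun _ : Fin (M + 1) => expMeasure 1) i
  have hs : MeasurableSet {p : ℝ × (Fin M → ℝ) | p.1 = p.2 k} :=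
    measurableSet_eq_fun (by fun_prop) (by fun_prop)
  have h0 : ((expMeasure 1).prod (Measure.pi fun _ : Fin M => expMeasure 1))
      {p : ℝ × (Fin M → ℝ) | p.1 = p.2 k} = 0 := by
    rw [Measure.prod_apply_symm hs]
    have : ∀ y : Fin M → ℝ, (fun x : ℝ => (x, y)) ⁻¹' {p : ℝ × (Fin M → ℝ) | p.1 = p.2 k}
        = {y k} := fun y => by ext x; simp
    simp [this]
  have h1 : ∀ᵐ p ∂((expMeasure 1).prod (Measure.pi fun _ : Fin M => expMeasure 1)),
      p.1 ≠ p.2 k := by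
    rw [ae_iff]
    simpa using h0
  filter_upwards [hmp.quasiMeasurePreserving.ae h1] with x hx _
  exact hx

lemma measurableSet_covered (M : ℕ) (c T : ℝ) :
    MeasurableSet {p : ℝ × (Fin M → ℝ) | T * (c + ∑ i, p.2 i) < p.1} :=
  measurableSet_lt (by fun_prop) (by fun_prop)

lemma measurableSet_covered_dominant (M : ℕ) (c T : ℝ) :
    MeasurableSet {p : ℝ × (Fin M → ℝ) | T * (c + ∑ i, p.2 i) < p.1 ∧ ∀ i, p.2 i < p.1} := by
  have : {p : ℝ × (Fin M → ℝ) | T * (c + ∑ i, p.2 i) < p.1 ∧ ∀ i, p.2 i < p.1} =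
      {p | T * (c + ∑ i, p.2 i) < p.1} ∩ ⋂ i, {p | p.2 i < p.1} := by
    ext p; simp
  rw [this]
  exact (measurableSet_covered M c T).inter
    (MeasurableSet.iInter fun i => measurableSet_lt (by fun_prop) (by fun_prop))

/-- Up to ties, exactly one beam is the strongest, and if some beam is covered then so is the
strongest one; by symmetry each beam contributes the same amount. -/
lemma real_exists_covered (M : ℕ) {c T : ℝ} (hT : 0 < T) :
    (Measure.pi fun _ : Fin (M + 1) => expMeasure 1).real
      {x | ∃ n, T * (c + ∑ i ∈ Finset.univ.erase n, x i) < x n} =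
    (M + 1) * ((expMeasure 1).prod (Measure.pi fun _ : Fin M => expMeasure 1)).real
      {p | T * (c + ∑ i, p.2 i) < p.1 ∧ ∀ i, p.2 i < p.1} := by
  set B' : Set (ℝ × (Fin M → ℝ)) := {p | T * (c + ∑ i, p.2 i) < p.1 ∧ ∀ i, p.2 i < p.1} with hB'
  let B : Fin (M + 1) → Set (Fin (M + 1) → ℝ) := fun n =>
    MeasurableEquiv.piFinSuccAbove (fun _ : Fin (M + 1) => ℝ) n ⁻¹' B'
  have hB'm : MeasurableSet B' := measurableSet_covered_dominant M c T
  have hBm : ∀ n, MeasurableSet (B n) := fun n => (MeasurableEquiv.measurable _) hB'm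
  have hmem : ∀ n (x : Fin (M + 1) → ℝ), x ∈ B n ↔
      T * (c + ∑ i ∈ Finset.univ.erase n, x i) < x n ∧ ∀ i, i ≠ n → x i < x n := by
    intro n x
    have hsum : ∑ i ∈ Finset.univ.erase n, x i = ∑ k, x (n.succAbove k) := by
      have h1 := Fin.sum_univ_succAbove x n
      have h2 := Finset.add_sum_erase Finset.univ x (Finset.mem_univ n)
      linarith
    have hall : (∀ i, i ≠ n → x i < x n) ↔ ∀ k, x (n.succAbove k) < x n := by
      refine ⟨fun H k => H _ (Fin.succAbove_ne n k), fun H i hi => ?_⟩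
      obtain ⟨k, rfl⟩ := Fin.exists_succAbove_eq hi
      exact H k
    rw [hsum, hall]
    rfl
  have hBr : ∀ n, (Measure.pi fun _ : Fin (M + 1) => expMeasure 1).real (B n) =
      ((expMeasure 1).prod (Measure.pi fun _ : Fin M => expMeasure 1)).real B' := by
    intro n
    have hmp := measurePreserving_piFinSuccAbove (fun _ : Fin (M + 1) => expMeasure 1) n
    rw [Measure.real, Measure.real, ← hmp.measure_preimage hB'm.nullMeasurableSet]
  have hdisj : Pairwise (Function.onFun Disjoint B) := by
    intro i j hij
    refine Set.disjoint_left.2 fun x hi hj => ?_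
    exact lt_asymm (((hmem i x).1 hi).2 j hij.symm) (((hmem j x).1 hj).2 i hij)
  have hae : {x : Fin (M + 1) → ℝ | ∃ n, T * (c + ∑ i ∈ Finset.univ.erase n, x i) < x n}
      =ᵐ[Measure.pi fun _ : Fin (M + 1) => expMeasure 1] ⋃ n, B n := by
    filter_upwards [ae_injective_pi_expMeasure_one M] with x hx
    refine propext ?_
    change (∃ n, T * (c + ∑ i ∈ Finset.univ.erase n, x i) < x n) ↔ x ∈ ⋃ n, B n
    simp only [Set.mem_iUnion, hmem]
    constructor
    -- Passing to the strongest beam raises the signal and lowers the interference.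
    · rintro ⟨n, hn⟩
      obtain ⟨k, hk⟩ := Finite.exists_max x
      refine ⟨k, lt_of_le_of_lt ?_ (lt_of_lt_of_le hn (hk n)), fun i hi =>
        lt_of_le_of_ne (hk i) (hx i k hi)⟩
      have h1 := Finset.add_sum_erase Finset.univ x (Finset.mem_univ n)
      have h2 := Finset.add_sum_erase Finset.univ x (Finset.mem_univ k)
      have h3 := hk n
      refine mul_le_mul_of_nonneg_left ?_ hT.le
      linarith
    · rintro ⟨n, hn, _⟩
      exact ⟨n, hn⟩
  rw [measureReal_congr hae, measureReal_iUnion_fintype hdisj hBm]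
  simp [hBr]

/-- For `T ≥ 1` a covered beam dominates all the others. -/
lemma real_covered_of_one_le (M : ℕ) {c T : ℝ} (hc : 0 ≤ c) (hT : 1 ≤ T) :
    ((expMeasure 1).prod (Measure.pi fun _ : Fin M => expMeasure 1)).real
      {p | T * (c + ∑ i, p.2 i) < p.1 ∧ ∀ i, p.2 i < p.1} =
      Real.exp (-(T * c)) / (T + 1) ^ M := by
  have hpos : ∀ᵐ p ∂((expMeasure 1).prod (Measure.pi fun _ : Fin M => expMeasure 1)),
      ∀ i, 0 < p.2 i := Measure.quasiMeasurePreserving_snd.ae (ae_pos_pi_expMeasure_one M)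
  have hae : {p : ℝ × (Fin M → ℝ) | T * (c + ∑ i, p.2 i) < p.1 ∧ ∀ i, p.2 i < p.1}
      =ᵐ[(expMeasure 1).prod (Measure.pi fun _ : Fin M => expMeasure 1)]
      {p | T * (c + ∑ i, p.2 i) < p.1} := by
    filter_upwards [hpos] with p hp
    refine propext (and_iff_left_of_imp fun (h : _ < _) i => lt_of_le_of_lt ?_ h)
    have h1 : p.2 i ≤ ∑ i, p.2 i :=
      Finset.single_le_sum (fun j _ => (hp j).le) (Finset.mem_univ i)
    have h2 := (hp i).le
    nlinarith
  rw [measureReal_congr hae, real_prod_apply_symm _ _ (measurableSet_covered M c T)]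
  have h1 : ∫ y, (expMeasure 1).real ((fun x => (x, y)) ⁻¹'
        {p : ℝ × (Fin M → ℝ) | T * (c + ∑ i, p.2 i) < p.1})
        ∂(Measure.pi fun _ : Fin M => expMeasure 1) =
      ∫ y, Real.exp (-(T * c)) * ∏ i, Real.exp (-(T * y i))
        ∂(Measure.pi fun _ : Fin M => expMeasure 1) := by
    refine integral_congr_ae ?_
    filter_upwards [ae_pos_pi_expMeasure_one M] with y hy
    have hs : 0 ≤ ∑ i, y i := Finset.sum_nonneg fun i _ => (hy i).le
    have : (fun x => (x, y)) ⁻¹' {p : ℝ × (Fin M → ℝ) | T * (c + ∑ i, p.2 i) < p.1} =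
      Set.Ioi (T * (c + ∑ i, y i)) := rfl
    rw [this, expMeasure_one_real_Ioi (by positivity), ← Real.exp_sum, ← Real.exp_add,
      Finset.sum_neg_distrib, ← Finset.mul_sum]
    congr 1
    ring
  have h2 : ∫ x, Real.exp (-(T * x)) ∂(expMeasure 1) = 1 / (T + 1) := by
    rw [integral_expMeasure_one]
    have : ∀ x : ℝ, Real.exp (-x) * Real.exp (-(T * x)) = Real.exp (-(T + 1) * x) := by
      intro x; rw [← Real.exp_add]; congr 1; ring
    simp_rw [this]
    rw [integral_exp_mul_Ioi (by linarith)]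
    rw [mul_zero, Real.exp_zero, neg_div_neg_eq]
  rw [h1, integral_const_mul, integral_fintype_prod_eq_pow (fun x => Real.exp (-(T * x))),
    h2]
  simp [div_eq_mul_inv]

/-! ### Sums of truncated exponential variables -/

/-- The truncated power `x₊ⁿ`; for `n = 0` it is the indicator function of `[0, ∞)`. -/
noncomputable def tpow (n : ℕ) (x : ℝ) : ℝ := if 0 ≤ x then x ^ n else 0

lemma tpow_of_nonneg {n : ℕ} {x : ℝ} (hx : 0 ≤ x) : tpow n x = x ^ n := if_pos hx

lemma tpow_of_neg {n : ℕ} {x : ℝ} (hx : x < 0) : tpow n x = 0 := if_neg (not_le.2 hx)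

@[fun_prop]
lemma measurable_tpow (n : ℕ) : Measurable (tpow n) :=
  Measurable.ite measurableSet_Ici (by fun_prop) measurable_const

lemma tpow_nonneg (n : ℕ) (x : ℝ) : 0 ≤ tpow n x := by
  unfold tpow; split_ifs <;> positivity

lemma norm_tpow_le (n : ℕ) (x : ℝ) : ‖tpow n x‖ ≤ ‖x ^ n‖ := by
  unfold tpow
  split_ifs
  · exact le_rfl
  · simp

lemma tpow_le_pow {n : ℕ} {x z : ℝ} (hz : 0 ≤ z) (hxz : x ≤ z) : tpow n x ≤ z ^ n := by
  unfold tpow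
  split_ifs with h
  · gcongr
  · positivity

lemma integral_tpow (n : ℕ) (a b : ℝ) :
    ∫ x in a..b, tpow n x = (tpow (n + 1) b - tpow (n + 1) a) / (n + 1) := by
  have hmon : ∀ u v : ℝ, IntervalIntegrable (tpow n) volume u v := by
    intro u v
    rw [intervalIntegrable_iff]
    have h1 : IntegrableOn (fun x : ℝ => x ^ n) (Set.uIoc u v) :=
      intervalIntegrable_iff.1 ((continuous_pow n).intervalIntegrable u v)
    refine Integrable.mono h1 (measurable_tpow n).aestronglyMeasurable
      (Filter.Eventually.of_forall fun x => norm_tpow_le n x)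
  have h0 : ∀ c : ℝ, ∫ x in 0..c, tpow n x = tpow (n + 1) c / (n + 1) := by
    intro c
    rcases le_or_gt 0 c with hc | hc
    · rw [tpow_of_nonneg hc, intervalIntegral.integral_congr (g := fun x => x ^ n)]
      · simp
      · intro x hx
        rw [Set.uIcc_of_le hc] at hx
        exact tpow_of_nonneg hx.1
    · rw [tpow_of_neg hc, zero_div, intervalIntegral.integral_symm, neg_eq_zero]
      rw [intervalIntegral.integral_of_le hc.le, integral_Ioc_eq_integral_Ioo]
      refine setIntegral_eq_zero_of_forall_eq_zero fun x hx => tpow_of_neg hx.2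
  rw [← intervalIntegral.integral_interval_sub_left (hmon 0 b) (hmon 0 a), h0, h0, sub_div]

/-- The density at `z`, relative to `e^{-z} dz`, of the sum of `M + 1` independent standard
exponential variables, restricted to the event that each of them is below `y`. -/
noncomputable def truncDensity (M : ℕ) (y z : ℝ) : ℝ :=
  ((M ! : ℝ))⁻¹ * ∑ t ∈ Finset.range (M + 2), ((M + 1).choose t : ℝ) * (-1) ^ t * tpow M (z - t * y)

@[fun_prop]
lemma measurable_truncDensity (M : ℕ) :
    Measurable fun p : ℝ × ℝ => truncDensity M p.1 p.2 := by
  unfold truncDensity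
  have : ∀ t : ℕ, Measurable fun p : ℝ × ℝ => tpow M (p.2 - t * p.1) := fun t =>
    (measurable_tpow M).comp (by fun_prop)
  fun_prop

lemma truncDensity_of_neg {M : ℕ} {y z : ℝ} (hy : 0 ≤ y) (hz : z < 0) :
    truncDensity M y z = 0 := by
  unfold truncDensity
  rw [Finset.sum_eq_zero, mul_zero]
  intro t _
  rw [tpow_of_neg, mul_zero]
  have : 0 ≤ (t : ℝ) * y := by positivity
  linarith

lemma abs_truncDensity_le (M : ℕ) {y z : ℝ} (hy : 0 ≤ y) (hz : 0 ≤ z) :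
    |truncDensity M y z| ≤ ((M ! : ℝ))⁻¹ * 2 ^ (M + 1) * z ^ M := by
  unfold truncDensity
  rw [abs_mul, abs_of_nonneg (by positivity : (0 : ℝ) ≤ ((M ! : ℝ))⁻¹), mul_assoc]
  refine mul_le_mul_of_nonneg_left ?_ (by positivity)
  refine (Finset.abs_sum_le_sum_abs _ _).trans ?_
  have h2 : ((2 : ℝ) ^ (M + 1)) = ∑ t ∈ Finset.range (M + 2), ((M + 1).choose t : ℝ) := by
    exact_mod_cast (Nat.sum_range_choose (M + 1)).symm
  rw [h2, Finset.sum_mul]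
  refine Finset.sum_le_sum fun t _ => ?_
  rw [abs_mul, abs_mul, abs_pow, abs_neg, abs_one, one_pow, mul_one, Nat.abs_cast,
    abs_of_nonneg (tpow_nonneg _ _)]
  refine mul_le_mul_of_nonneg_left (tpow_le_pow hz ?_) (by positivity)
  have : 0 ≤ (t : ℝ) * y := by positivity
  linarith

/-- Pascal's rule for alternating binomial sums. -/
lemma sum_choose_mul_sub (n : ℕ) (A : ℕ → ℝ) :
    ∑ t ∈ Finset.range (n + 1), (n.choose t : ℝ) * (-1) ^ t * (A t - A (t + 1)) =
      ∑ t ∈ Finset.range (n + 2), ((n + 1).choose t : ℝ) * (-1) ^ t * A t := by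
  rw [Finset.sum_range_succ' _ (n + 1)]
  simp only [Nat.choose_succ_succ, Nat.cast_add, add_mul, mul_sub, Finset.sum_sub_distrib,
    Finset.sum_add_distrib]
  have h1 : ∑ t ∈ Finset.range (n + 1), (n.choose (t + 1) : ℝ) * (-1) ^ (t + 1) * A (t + 1) +
      (n.choose 0 : ℝ) * (-1) ^ 0 * A 0 =
      ∑ t ∈ Finset.range (n + 1), (n.choose t : ℝ) * (-1) ^ t * A t := by
    rw [← Finset.sum_range_succ' (fun t => (n.choose t : ℝ) * (-1) ^ t * A t),
      Finset.sum_range_succ]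
    simp
  rw [← h1]
  simp only [Nat.choose_zero_right, pow_succ, mul_neg, mul_one, neg_mul, Finset.sum_neg_distrib]
  ring

/-- Convolving with one more truncated exponential variable. -/
lemma integral_truncDensity (M : ℕ) (y z : ℝ) :
    ∫ x in 0..y, truncDensity M y (z - x) = truncDensity (M + 1) y z := by
  have hint : ∀ t : ℕ, IntervalIntegrable (fun x => tpow M (z - x - t * y)) volume 0 y := by
    intro t
    rw [intervalIntegrable_iff]
    have h1 : IntegrableOn (fun x : ℝ => (z - x - t * y) ^ M) (Set.uIoc 0 y) :=
      intervalIntegrable_iff.1 ((by fun_prop : Continuous fun x : ℝ =>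
        (z - x - t * y) ^ M).intervalIntegrable 0 y)
    refine Integrable.mono h1 ((measurable_tpow M).comp (by fun_prop)).aestronglyMeasurable
      (Filter.Eventually.of_forall fun x => norm_tpow_le M _)
  have hone : ∀ t : ℕ, ∫ x in 0..y, tpow M (z - x - t * y) =
      (tpow (M + 1) (z - t * y) - tpow (M + 1) (z - (t + 1 : ℕ) * y)) / (M + 1) := by
    intro t
    have : ∀ x : ℝ, tpow M (z - x - t * y) = tpow M (z - t * y - x) := fun x => by
      congr 1; ring
    simp_rw [this]
    rw [intervalIntegral.integral_comp_sub_left (fun x => tpow M x), integral_tpow]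
    congr 3
    · ring
    · push_cast; ring
  unfold truncDensity
  rw [intervalIntegral.integral_const_mul, intervalIntegral.integral_finsetSum
    (fun t _ => (hint t).const_mul _)]
  simp_rw [intervalIntegral.integral_const_mul, hone, ← mul_div_assoc]
  rw [← Finset.sum_div, sum_choose_mul_sub (M + 1) (fun t => tpow (M + 1) (z - t * y)),
    Nat.factorial_succ]
  push_cast
  rw [mul_inv, ← mul_div_assoc, mul_comm ((M : ℝ) + 1)⁻¹, mul_assoc, mul_comm ((M : ℝ) + 1)⁻¹,
    ← div_eq_mul_inv, ← mul_div_assoc]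

/-- Conditioning on the first variable. -/
lemma real_truncSum_succ (M : ℕ) {y : ℝ} (hy : 0 ≤ y) (s : ℝ) :
    (Measure.pi fun _ : Fin (M + 1) => expMeasure 1).real {x | (∀ i, x i < y) ∧ ∑ i, x i < s} =
      ∫ x in 0..y, Real.exp (-x) *
        (Measure.pi fun _ : Fin M => expMeasure 1).real
          {x' | (∀ i, x' i < y) ∧ ∑ i, x' i < s - x} := by
  have hmp := measurePreserving_piFinSuccAbove (fun _ : Fin (M + 1) => expMeasure 1) 0
  set B : Set (ℝ × (Fin M → ℝ)) :=
    {p | p.1 < y ∧ (∀ i, p.2 i < y) ∧ ∑ i, p.2 i < s - p.1} with hB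
  have hBm : MeasurableSet B := by
    have : B = {p | p.1 < y} ∩ ((⋂ i, {p | p.2 i < y}) ∩ {p | ∑ i, p.2 i < s - p.1}) := by
      ext p; simp [hB]
    rw [this]
    exact (measurableSet_lt (by fun_prop) (by fun_prop)).inter
      ((MeasurableSet.iInter fun i => measurableSet_lt (by fun_prop) (by fun_prop)).inter
      (measurableSet_lt (by fun_prop) (by fun_prop)))
  have hpre : {x : Fin (M + 1) → ℝ | (∀ i, x i < y) ∧ ∑ i, x i < s} =
      MeasurableEquiv.piFinSuccAbove (fun _ : Fin (M + 1) => ℝ) 0 ⁻¹' B := by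
    ext x
    change (∀ i, x i < y) ∧ ∑ i, x i < s ↔ x 0 < y ∧ (∀ i : Fin M, x (Fin.succAbove 0 i) < y) ∧
      ∑ i : Fin M, x (Fin.succAbove 0 i) < s - x 0
    rw [Fin.forall_fin_succ, Fin.sum_univ_succ, and_assoc, lt_sub_iff_add_lt']
    rfl
  rw [hpre, Measure.real, hmp.measure_preimage hBm.nullMeasurableSet, ← Measure.real,
    real_prod_apply _ _ hBm, integral_expMeasure_one, intervalIntegral.integral_of_le hy,
    integral_Ioc_eq_integral_Ioo, ← Set.Ioi_inter_Iio,
    ← setIntegral_indicator measurableSet_Iio]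
  refine setIntegral_congr_fun measurableSet_Ioi fun x _ => ?_
  by_cases hx : x < y
  · rw [Set.indicator_of_mem (Set.mem_Iio.2 hx)]
    congr 2
    ext x'
    simp [hB, hx]
  · rw [Set.indicator_of_notMem (by simpa using hx)]
    have : Prod.mk x ⁻¹' B = ∅ := by
      ext x'
      simp [hB, hx]
    simp [this]

/-- Distribution function of the sum of `M + 1` independent exponential variables, on the event
that all of them are below `y`. -/
lemma real_truncSum (M : ℕ) {y : ℝ} (hy : 0 ≤ y) (s : ℝ) :
    (Measure.pi fun _ : Fin (M + 1) => expMeasure 1).real {x | (∀ i, x i < y) ∧ ∑ i, x i < s} =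
      ∫ z in 0..s, Real.exp (-z) * truncDensity M y z := by
  induction M generalizing s with
  | zero =>
    rw [real_truncSum_succ 0 hy]
    have h1 : ∀ x : ℝ, (Measure.pi fun _ : Fin 0 => expMeasure 1).real
        {x' : Fin 0 → ℝ | (∀ i, x' i < y) ∧ ∑ i, x' i < s - x} = if x < s then 1 else 0 := by
      intro x
      split_ifs with h <;> simp [h]
    have h2 : ∀ z : ℝ, 0 ≤ z → truncDensity 0 y z = if z < y then 1 else 0 := by
      intro z hz
      rw [truncDensity, Finset.sum_range_succ, Finset.sum_range_one]
      split_ifs with h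
      · simp [tpow, hz, h]
      · simp [tpow, hz, not_lt.1 h]
    simp_rw [h1]
    rcases le_or_gt 0 s with hs | hs
    · have h3 : ∀ u v : ℝ, 0 ≤ u → ∫ x in 0..u, Real.exp (-x) * (if x < v then 1 else 0) =
          ∫ x in Set.Ioi 0 ∩ Set.Iio u ∩ Set.Iio v, Real.exp (-x) := by
        intro u v hu
        rw [intervalIntegral.integral_of_le hu, integral_Ioc_eq_integral_Ioo,
          ← setIntegral_indicator measurableSet_Iio, Set.Ioi_inter_Iio]
        refine setIntegral_congr_fun measurableSet_Ioo fun x _ => ?_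
        by_cases hx : x < v <;> simp [hx]
      have h4 : ∫ z in 0..s, Real.exp (-z) * truncDensity 0 y z =
          ∫ z in 0..s, Real.exp (-z) * (if z < y then 1 else 0) := by
        refine intervalIntegral.integral_congr fun z hz => ?_
        rw [Set.uIcc_of_le hs] at hz
        simp only [h2 z hz.1]
      rw [h4, h3 _ _ hy, h3 _ _ hs, Set.inter_right_comm]
    · rw [intervalIntegral.integral_symm s 0, intervalIntegral.integral_of_le hs.le,
        integral_Ioc_eq_integral_Ioo, intervalIntegral.integral_of_le hy]
      rw [setIntegral_eq_zero_of_forall_eq_zero, setIntegral_eq_zero_of_forall_eq_zero, neg_zero]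
      · intro z hz
        rw [truncDensity_of_neg hy hz.2, mul_zero]
      · intro x hx
        rw [if_neg (by linarith [hx.1]), mul_zero]
  | succ M ih =>
    rw [real_truncSum_succ (M + 1) hy]
    simp_rw [ih]
    have hneg : ∀ z : ℝ, z < 0 → Real.exp (-z) * truncDensity M y z = 0 := fun z hz => by
      rw [truncDensity_of_neg hy hz, mul_zero]
    have hint : IntegrableOn (fun p : ℝ × ℝ => Real.exp (-p.2) * truncDensity M y (p.2 - p.1))
        (Set.uIoc 0 y ×ˢ Set.uIoc 0 s) := by
      unfold truncDensity
      simp_rw [Finset.mul_sum]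
      refine integrable_finsetSum _ fun t _ => ?_
      have hc : IntegrableOn (fun p : ℝ × ℝ => Real.exp (-p.2) * ((M ! : ℝ)⁻¹ *
          (((M + 1).choose t : ℝ) * (-1) ^ t * (p.2 - p.1 - t * y) ^ M)))
          (Set.uIoc 0 y ×ˢ Set.uIoc 0 s) :=
        (((by fun_prop : Continuous fun p : ℝ × ℝ => Real.exp (-p.2) * ((M ! : ℝ)⁻¹ *
          (((M + 1).choose t : ℝ) * (-1) ^ t * (p.2 - p.1 - t * y) ^ M))).continuousOn
          ).integrableOn_compact (isCompact_uIcc.prod isCompact_uIcc)).mono_set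
          (Set.prod_mono Set.uIoc_subset_uIcc Set.uIoc_subset_uIcc)
      have hm : Measurable fun p : ℝ × ℝ => tpow M (p.2 - p.1 - t * y) :=
        (measurable_tpow M).comp (by fun_prop)
      refine Integrable.mono hc (by fun_prop) (Filter.Eventually.of_forall fun p => ?_)
      simp only [norm_mul]
      gcongr
      exact norm_tpow_le M _
    have hF : ∀ a b : ℝ, IntervalIntegrable (fun z => Real.exp (-z) * truncDensity M y z)
        volume a b := by
      intro a b
      unfold truncDensity
      simp_rw [Finset.mul_sum]
      rw [intervalIntegrable_iff]
      refine integrable_finsetSum _ fun t _ => ?_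
      have hc : IntervalIntegrable (fun z : ℝ => Real.exp (-z) * ((M ! : ℝ)⁻¹ *
          (((M + 1).choose t : ℝ) * (-1) ^ t * (z - t * y) ^ M))) volume a b :=
        (by fun_prop : Continuous fun z : ℝ => Real.exp (-z) * ((M ! : ℝ)⁻¹ *
          (((M + 1).choose t : ℝ) * (-1) ^ t * (z - t * y) ^ M))).intervalIntegrable a b
      have hm : Measurable fun z : ℝ => tpow M (z - t * y) :=
        (measurable_tpow M).comp (by fun_prop)
      refine Integrable.mono (intervalIntegrable_iff.1 hc) (by fun_prop)
        (Filter.Eventually.of_forall fun p => ?_)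
      simp only [norm_mul]
      gcongr
      exact norm_tpow_le M _
    -- Shifting `z` by `x` absorbs the factor `e^{-x}`; the shifted density vanishes on `[0, x)`.
    have h1 : ∀ x ∈ Set.uIcc 0 y, Real.exp (-x) *
        ∫ z in 0..(s - x), Real.exp (-z) * truncDensity M y z =
        ∫ z in 0..s, Real.exp (-z) * truncDensity M y (z - x) := by
      intro x hx
      rw [Set.uIcc_of_le hy] at hx
      have h2 : ∀ z : ℝ, Real.exp (-z) * truncDensity M y (z - x) =
          Real.exp (-x) * (Real.exp (-(z - x)) * truncDensity M y (z - x)) := by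
        intro z
        rw [← mul_assoc, ← Real.exp_add]
        congr 2
        ring
      simp_rw [h2]
      rw [intervalIntegral.integral_const_mul, intervalIntegral.integral_comp_sub_right
        (fun z => Real.exp (-z) * truncDensity M y z), zero_sub,
        ← intervalIntegral.integral_add_adjacent_intervals (hF (-x) 0) (hF 0 (s - x))]
      have h3 : ∫ z in (-x)..0, Real.exp (-z) * truncDensity M y z = 0 := by
        rw [intervalIntegral.integral_of_le (by linarith [hx.1]), integral_Ioc_eq_integral_Ioo]
        exact setIntegral_eq_zero_of_forall_eq_zero fun z hz => hneg z hz.2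
      rw [h3, zero_add]
    rw [intervalIntegral.integral_congr h1]
    rcases le_or_gt 0 s with hs | hs
    · simp_rw [intervalIntegral.integral_of_le hs]
      rw [intervalIntegral_integral_swap]
      · simp_rw [intervalIntegral.integral_const_mul, integral_truncDensity]
      · rw [Measure.prod_restrict, ← Measure.volume_eq_prod]
        rwa [Set.uIoc_of_le hs] at hint
    -- For `s < 0` both sides vanish.
    · have h4 : ∀ (K : ℕ) (x : ℝ), 0 ≤ x →
          ∫ z in 0..s, Real.exp (-z) * truncDensity K y (z - x) = 0 := by
        intro K x hx
        rw [intervalIntegral.integral_symm s 0, intervalIntegral.integral_of_le hs.le,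
          integral_Ioc_eq_integral_Ioo, setIntegral_eq_zero_of_forall_eq_zero, neg_zero]
        intro z hz
        rw [truncDensity_of_neg hy (by linarith [hz.2]), mul_zero]
      have h5 := h4 (M + 1) 0 le_rfl
      simp only [sub_zero] at h5
      rw [h5, intervalIntegral.integral_congr (g := fun _ => 0)]
      · simp
      · intro x hx
        rw [Set.uIcc_of_le hy] at hx
        exact h4 M x hx.1

/-! ### The region of coverage and its cones -/

lemma integrableOn_exp_neg_mul_pow (n : ℕ) :
    IntegrableOn (fun z : ℝ => Real.exp (-z) * z ^ n) (Set.Ioi 0) := by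
  have h := Real.GammaIntegral_convergent (s := n + 1) (by positivity)
  refine h.congr_fun (fun z _ => ?_) measurableSet_Ioi
  simp

lemma integrable_exp_mul_truncDensity (M : ℕ) :
    Integrable (fun p : ℝ × ℝ => Real.exp (-p.1) * (Real.exp (-p.2) * truncDensity M p.1 p.2))
      ((volume.restrict (Set.Ioi 0)).prod (volume.restrict (Set.Ioi 0))) := by
  have h0 : IntegrableOn (fun z : ℝ => Real.exp (-z)) (Set.Ioi 0) := by
    simpa using integrableOn_exp_neg_mul_pow 0
  have h1 := Integrable.mul_prod h0
    ((integrableOn_exp_neg_mul_pow M).const_mul (((M ! : ℝ))⁻¹ * 2 ^ (M + 1)))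
  refine h1.mono' (by fun_prop) ?_
  rw [Measure.prod_restrict]
  filter_upwards [ae_restrict_mem (measurableSet_Ioi.prod measurableSet_Ioi)] with p hp
  rw [norm_mul, norm_mul, Real.norm_of_nonneg (Real.exp_nonneg _),
    Real.norm_of_nonneg (Real.exp_nonneg _), Real.norm_eq_abs]
  refine mul_le_mul_of_nonneg_left ?_ (Real.exp_nonneg _)
  calc _ ≤ Real.exp (-p.2) * (((M ! : ℝ))⁻¹ * 2 ^ (M + 1) * p.2 ^ M) :=
        mul_le_mul_of_nonneg_left (abs_truncDensity_le M (le_of_lt hp.1) (le_of_lt hp.2))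
          (Real.exp_nonneg _)
    _ = _ := by ring

/-- The probability that a given beam dominates the `M + 1` others and is covered, as an
integral over the total interference `z` and the power `y` of that beam. -/
lemma real_covered_eq_integral (M : ℕ) {c T : ℝ} (hc : 0 < c) (hT : 0 < T) :
    ((expMeasure 1).prod (Measure.pi fun _ : Fin (M + 1) => expMeasure 1)).real
      {p | T * (c + ∑ i, p.2 i) < p.1 ∧ ∀ i, p.2 i < p.1} =
    ∫ z in Set.Ioi 0, Real.exp (-z) *
      ∫ y in Set.Ioi (T * (c + z)), Real.exp (-y) * truncDensity M y z := by
  have hm := measurableSet_covered_dominant (M + 1) c T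
  let S : Set (ℝ × ℝ) := {p | T * (c + p.2) < p.1}
  have hS : MeasurableSet S := measurableSet_lt (by fun_prop) (by fun_prop)
  let F : ℝ → ℝ → ℝ := fun y z =>
    S.indicator (fun p => Real.exp (-p.1) * (Real.exp (-p.2) * truncDensity M p.1 p.2)) (y, z)
  have hF : Integrable (Function.uncurry F)
      ((volume.restrict (Set.Ioi 0)).prod (volume.restrict (Set.Ioi 0))) :=
    (integrable_exp_mul_truncDensity M).indicator hS
  rw [real_prod_apply _ _ hm, integral_expMeasure_one]
  have h1 : ∀ y ∈ Set.Ioi (0 : ℝ), Real.exp (-y) *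
      (Measure.pi fun _ : Fin (M + 1) => expMeasure 1).real
      (Prod.mk y ⁻¹' {p | T * (c + ∑ i, p.2 i) < p.1 ∧ ∀ i, p.2 i < p.1}) =
      ∫ z in Set.Ioi 0, F y z := by
    intro y hy
    have hy' : (0 : ℝ) < y := hy
    have hiff : ∀ z : ℝ, (T * (c + z) < y) ↔ z < y / T - c := by
      intro z
      rw [lt_sub_iff_add_lt', lt_div_iff₀ hT, mul_comm]
    have h2 : Prod.mk y ⁻¹' {p : ℝ × (Fin (M + 1) → ℝ) |
        T * (c + ∑ i, p.2 i) < p.1 ∧ ∀ i, p.2 i < p.1} =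
        {x | (∀ i, x i < y) ∧ ∑ i, x i < y / T - c} := by
      ext x
      change (_ < y ∧ ∀ i, x i < y) ↔ (∀ i, x i < y) ∧ _
      rw [hiff, and_comm]
    rw [h2, real_truncSum M hy'.le]
    have h3 : ∀ z : ℝ, F y z = Real.exp (-y) * (Set.Iio (y / T - c)).indicator
        (fun z => Real.exp (-z) * truncDensity M y z) z := by
      intro z
      by_cases hz : z < y / T - c
      · rw [Set.indicator_of_mem (Set.mem_Iio.2 hz)]
        exact Set.indicator_of_mem (show (y, z) ∈ S from (hiff z).2 hz) _
      · rw [Set.indicator_of_notMem (by simpa using hz), mul_zero]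
        exact Set.indicator_of_notMem (fun h : (y, z) ∈ S => hz ((hiff z).1 h)) _
    simp_rw [h3]
    rw [integral_const_mul, setIntegral_indicator measurableSet_Iio, Set.Ioi_inter_Iio]
    rcases le_or_gt 0 (y / T - c) with hs | hs
    · rw [intervalIntegral.integral_of_le hs, integral_Ioc_eq_integral_Ioo]
    · rw [Set.Ioo_eq_empty (by linarith), setIntegral_empty,
        intervalIntegral.integral_symm (y / T - c) 0, intervalIntegral.integral_of_le hs.le,
        integral_Ioc_eq_integral_Ioo, setIntegral_eq_zero_of_forall_eq_zero, neg_zero]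
      intro z hz
      rw [truncDensity_of_neg hy'.le hz.2, mul_zero]
  rw [setIntegral_congr_fun measurableSet_Ioi h1, integral_integral_swap hF]
  refine setIntegral_congr_fun measurableSet_Ioi fun z hz => ?_
  have hz' : (0 : ℝ) < z := hz
  have h4 : ∀ y : ℝ, F y z = Real.exp (-z) * (Set.Ioi (T * (c + z))).indicator
      (fun y => Real.exp (-y) * truncDensity M y z) y := by
    intro y
    by_cases hy : T * (c + z) < y
    · rw [Set.indicator_of_mem (Set.mem_Ioi.2 hy)]
      exact (Set.indicator_of_mem (show (y, z) ∈ S from hy) _).trans (by ring)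
    · rw [Set.indicator_of_notMem (by simpa using hy), mul_zero]
      exact Set.indicator_of_notMem (fun h : (y, z) ∈ S => hy h) _
  simp_rw [h4]
  rw [integral_const_mul, setIntegral_indicator measurableSet_Ioi, Set.Ioi_inter_Ioi,
    sup_eq_right.2 (by positivity)]

lemma integrableOn_exp_mul_truncDensity (M : ℕ) {z u : ℝ} (hz : 0 ≤ z) (hu : 0 ≤ u) :
    IntegrableOn (fun y => Real.exp (-y) * truncDensity M y z) (Set.Ioi u) := by
  have h0 : IntegrableOn (fun y : ℝ => Real.exp (-y)) (Set.Ioi u) := by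
    have := (integrableOn_exp_neg_mul_pow 0).mono_set (Set.Ioi_subset_Ioi hu)
    simpa using this
  have hm : Measurable fun y : ℝ => truncDensity M y z :=
    (measurable_truncDensity M).comp (by fun_prop : Measurable fun y : ℝ => (y, z))
  refine (h0.mul_const (((M ! : ℝ))⁻¹ * 2 ^ (M + 1) * z ^ M)).mono' (by fun_prop) ?_
  filter_upwards [ae_restrict_mem measurableSet_Ioi] with y hy
  rw [norm_mul, Real.norm_of_nonneg (Real.exp_nonneg _), Real.norm_eq_abs]
  exact mul_le_mul_of_nonneg_left
    (abs_truncDensity_le M (hu.trans (le_of_lt hy)) hz) (Real.exp_nonneg _)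

/-- On `z / p < y ≤ z / (p - 1)` exactly the first `p` terms of the truncated density survive. -/
lemma truncDensity_eq (M : ℕ) {p : ℕ} {y z : ℝ} (hy : 0 < y) (h1 : z < p * y)
    (h2 : ((p : ℝ) - 1) * y ≤ z) :
    truncDensity M y z = ((M ! : ℝ))⁻¹ * ∑ t ∈ Finset.range p,
      ((M + 1).choose t : ℝ) * (-1) ^ t * (z - t * y) ^ M := by
  unfold truncDensity
  congr 1
  -- Either range may be the longer one: beyond `M + 1` the binomial coefficient vanishes, and
  -- from `p` on the truncated power does.
  let f : ℕ → ℝ := fun t => ((M + 1).choose t : ℝ) * (-1) ^ t * tpow M (z - t * y)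
  have e1 : ∑ t ∈ Finset.range (M + 2), f t = ∑ t ∈ Finset.range (max (M + 2) p), f t := by
    refine Finset.sum_subset (Finset.range_subset_range.2 (le_max_left _ _)) fun t _ ht => ?_
    simp only [f]
    rw [Nat.choose_eq_zero_of_lt (by simp at ht; omega)]
    simp
  have e2 : ∑ t ∈ Finset.range p, f t = ∑ t ∈ Finset.range (max (M + 2) p), f t := by
    refine Finset.sum_subset (Finset.range_subset_range.2 (le_max_right _ _)) fun t _ ht => ?_
    simp only [f]
    rw [tpow_of_neg, mul_zero]
    have : (p : ℝ) ≤ t := by exact_mod_cast (by simpa using ht : p ≤ t)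
    nlinarith
  change ∑ t ∈ Finset.range (M + 2), f t = _
  rw [e1, ← e2]
  refine Finset.sum_congr rfl fun t ht => ?_
  simp only [f]
  rw [tpow_of_nonneg]
  have : (t : ℝ) ≤ p - 1 := by
    have : t + 1 ≤ p := by simpa using ht
    have : ((t + 1 : ℕ) : ℝ) ≤ p := by exact_mod_cast this
    push_cast at this
    linarith
  nlinarith

/-- The half-line `y > a` is cut at the points `z / p`; the endpoints are clamped to `a`. The
hypothesis on `a` says that no further cone meets the half-line. -/
lemma integral_truncDensity_split (M : ℕ) {m : ℕ} (hm : 1 ≤ m) {a z : ℝ} (hz : 0 < z)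
    (ha : z / m ≤ a) :
    ∫ y in Set.Ioi a, Real.exp (-y) * truncDensity M y z =
      (∫ y in Set.Ioi (max a z), Real.exp (-y) * (((M ! : ℝ))⁻¹ * z ^ M)) +
      ∑ p ∈ Finset.Icc 2 m, ∫ y in (max a (z / p))..(max a (z / ((p : ℝ) - 1))),
        Real.exp (-y) * (((M ! : ℝ))⁻¹ * ∑ t ∈ Finset.range p,
          ((M + 1).choose t : ℝ) * (-1) ^ t * (z - t * y) ^ M) := by
  have ha0 : 0 < a := lt_of_lt_of_le (by positivity) ha
  have hint : ∀ u : ℝ, 0 ≤ u →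
      IntegrableOn (fun y => Real.exp (-y) * truncDensity M y z) (Set.Ioi u) :=
    fun u hu => integrableOn_exp_mul_truncDensity M hz.le hu
  have htel : ∀ n : ℕ, 1 ≤ n →
      ∫ y in Set.Ioi (max a (z / n)), Real.exp (-y) * truncDensity M y z =
      (∫ y in Set.Ioi (max a z), Real.exp (-y) * (((M ! : ℝ))⁻¹ * z ^ M)) +
      ∑ p ∈ Finset.Icc 2 n, ∫ y in (max a (z / p))..(max a (z / ((p : ℝ) - 1))),
        Real.exp (-y) * (((M ! : ℝ))⁻¹ * ∑ t ∈ Finset.range p,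
          ((M + 1).choose t : ℝ) * (-1) ^ t * (z - t * y) ^ M) := by
    intro n hn
    induction n, hn using Nat.le_induction with
    | base =>
      simp only [Nat.cast_one, div_one]
      rw [Finset.Icc_eq_empty (by norm_num), Finset.sum_empty, add_zero]
      refine setIntegral_congr_fun measurableSet_Ioi fun y hy => ?_
      have hy' : max a z < y := hy
      have h1 : 0 < y := (ha0.trans_le (le_max_left _ _)).trans hy'
      have h2 : z < y := (le_max_right _ _).trans_lt hy'
      rw [truncDensity_eq M (p := 1) h1 (by simpa using h2) (by simpa using hz.le)]
      simp
    | succ n hn ih =>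
      have hn0 : (0 : ℝ) < n := by exact_mod_cast hn
      have hlo : max a (z / ((n + 1 : ℕ) : ℝ)) ≤ max a (z / n) := by
        refine max_le_max le_rfl (div_le_div_of_nonneg_left hz.le hn0 ?_)
        push_cast; linarith
      rw [Finset.sum_Icc_succ_top (by omega), ← add_assoc, ← ih, ← sub_eq_iff_eq_add',
        intervalIntegral.integral_Ioi_sub_Ioi (hint _ (ha0.le.trans (le_max_left _ _))) hlo]
      push_cast
      rw [add_sub_cancel_right]
      push_cast at hlo
      rw [intervalIntegral.integral_of_le hlo, intervalIntegral.integral_of_le hlo]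
      refine setIntegral_congr_fun measurableSet_Ioc fun y hy => ?_
      have hya : a < y := (le_max_left _ _).trans_lt hy.1
      have h1 : z < ((n + 1 : ℕ) : ℝ) * y := by
        have := (le_max_right _ _).trans_lt hy.1
        rw [div_lt_iff₀ (by positivity)] at this
        push_cast
        linarith
      have h2 : (((n + 1 : ℕ) : ℝ) - 1) * y ≤ z := by
        rcases le_max_iff.1 hy.2 with h | h
        · exact absurd h (not_le.2 hya)
        · rw [le_div_iff₀ hn0] at h
          push_cast
          linarith
      rw [truncDensity_eq M (ha0.trans hya) h1 h2]
  have := htel m hm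
  rwa [max_eq_left ha] at this

/-! ### Incomplete gamma integrals -/

/-- Closed form of the upper incomplete gamma integral `∫ z in (u, ∞), e^{-κ z} z ^ n`. -/
noncomputable def gammaTail (κ : ℝ) (n : ℕ) (u : ℝ) : ℝ :=
  (n ! : ℝ) / κ ^ (n + 1) * Real.exp (-κ * u) *
    ∑ j ∈ Finset.range (n + 1), κ ^ j * (u ^ j / (j ! : ℝ))

lemma hasDerivAt_gammaTail {κ : ℝ} (hκ : κ ≠ 0) (n : ℕ) (u : ℝ) :
    HasDerivAt (gammaTail κ n) (-(Real.exp (-κ * u) * u ^ n)) u := by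
  have he : HasDerivAt (fun u => Real.exp (-κ * u)) (Real.exp (-κ * u) * -κ) u := by
    simpa using ((hasDerivAt_id u).const_mul (-κ)).exp
  -- The derivative of the sum telescopes.
  have hsum : HasDerivAt (fun u => Real.exp (-κ * u) *
      ∑ j ∈ Finset.range (n + 1), κ ^ j * (u ^ j / (j ! : ℝ)))
      (-κ * (Real.exp (-κ * u) * (κ ^ n * (u ^ n / (n ! : ℝ))))) u := by
    induction n with
    | zero => simpa [mul_comm] using he
    | succ n ih =>
      simp_rw [Finset.sum_range_succ _ (n + 1), mul_add]
      have h1 : HasDerivAt (fun u : ℝ => κ ^ (n + 1) * (u ^ (n + 1) / ((n + 1)! : ℝ)))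
          (κ ^ (n + 1) * (((n + 1 : ℕ) : ℝ) * u ^ n / ((n + 1)! : ℝ))) u := by
        simpa using ((hasDerivAt_pow (n + 1) u).div_const ((n + 1)! : ℝ)).const_mul (κ ^ (n + 1))
      refine (ih.add (he.mul h1)).congr_deriv ?_
      rw [Nat.factorial_succ]
      push_cast
      field_simp
      ring
  have h2 : gammaTail κ n = fun u => (n ! : ℝ) / κ ^ (n + 1) * (Real.exp (-κ * u) *
      ∑ j ∈ Finset.range (n + 1), κ ^ j * (u ^ j / (j ! : ℝ))) := by
    ext u; rw [gammaTail, mul_assoc]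
  rw [h2]
  refine (hsum.const_mul _).congr_deriv ?_
  field_simp
  ring

lemma hasDerivAt_neg_gammaTail {κ : ℝ} (hκ : κ ≠ 0) (n : ℕ) (u : ℝ) :
    HasDerivAt (fun z => -gammaTail κ n z) (Real.exp (-κ * u) * u ^ n) u :=
  (hasDerivAt_gammaTail hκ n u).neg.congr_deriv (neg_neg _)

lemma tendsto_gammaTail {κ : ℝ} (hκ : 0 < κ) (n : ℕ) :
    Filter.Tendsto (gammaTail κ n) Filter.atTop (nhds 0) := by
  have h1 : ∀ j : ℕ, Filter.Tendsto (fun u : ℝ => (κ * u) ^ j * Real.exp (-(κ * u)))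
      Filter.atTop (nhds 0) := fun j =>
    (Real.tendsto_pow_mul_exp_neg_atTop_nhds_zero j).comp
      (Filter.tendsto_id.const_mul_atTop hκ)
  have h2 : gammaTail κ n = fun u => ∑ j ∈ Finset.range (n + 1),
      (n ! : ℝ) / κ ^ (n + 1) / (j ! : ℝ) * ((κ * u) ^ j * Real.exp (-(κ * u))) := by
    ext u
    rw [gammaTail, Finset.mul_sum]
    refine Finset.sum_congr rfl fun j _ => ?_
    rw [mul_pow, neg_mul]
    ring
  rw [h2]
  have h3 := tendsto_finsetSum (Finset.range (n + 1)) fun j _ =>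
    (h1 j).const_mul ((n ! : ℝ) / κ ^ (n + 1) / (j ! : ℝ))
  simpa using h3

lemma integrableOn_exp_mul_pow {κ : ℝ} (hκ : 0 < κ) (n : ℕ) {u : ℝ} (hu : 0 ≤ u) :
    IntegrableOn (fun z => Real.exp (-κ * z) * z ^ n) (Set.Ioi u) := by
  refine integrableOn_Ioi_deriv_of_nonneg' (g := fun z => -gammaTail κ n z) (l := -0)
    (fun z _ => hasDerivAt_neg_gammaTail hκ.ne' n z)
    (fun z hz => ?_) (tendsto_gammaTail hκ n).neg
  have : 0 < z := hu.trans_lt hz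
  positivity

lemma setIntegral_Ioi_exp_mul_pow {κ : ℝ} (hκ : 0 < κ) (n : ℕ) {u : ℝ} (hu : 0 ≤ u) :
    ∫ z in Set.Ioi u, Real.exp (-κ * z) * z ^ n = gammaTail κ n u := by
  rw [integral_Ioi_of_hasDerivAt_of_nonneg' (g := fun z => -gammaTail κ n z) (l := -0)
    (fun z _ => hasDerivAt_neg_gammaTail hκ.ne' n z)
    (fun z hz => ?_) (tendsto_gammaTail hκ n).neg]
  · simp
  · have : 0 < z := hu.trans_lt hz
    positivity

lemma gammaTail_zero {κ : ℝ} (n : ℕ) : gammaTail κ n 0 = (n ! : ℝ) / κ ^ (n + 1) := by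
  rw [gammaTail, Finset.sum_range_succ']
  simp

lemma intervalIntegral_exp_mul_sub_pow (M : ℕ) (z t u v : ℝ) :
    ∫ y in u..v, Real.exp (-y) * (z - t * y) ^ M =
      ∑ i ∈ Finset.range (M + 1), (M.choose i : ℝ) * (-t) ^ i * z ^ (M - i) *
        (gammaTail 1 i u - gammaTail 1 i v) := by
  have h1 : ∀ y : ℝ, Real.exp (-y) * (z - t * y) ^ M =
      ∑ i ∈ Finset.range (M + 1), (M.choose i : ℝ) * (-t) ^ i * z ^ (M - i) *
        (Real.exp (-1 * y) * y ^ i) := by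
    intro y
    rw [sub_eq_neg_add, add_pow, Finset.mul_sum]
    refine Finset.sum_congr rfl fun i _ => ?_
    rw [← neg_mul, mul_pow, neg_one_mul]
    ring
  simp_rw [h1]
  rw [intervalIntegral.integral_finsetSum fun i _ =>
    (by fun_prop : Continuous fun y : ℝ => (M.choose i : ℝ) * (-t) ^ i * z ^ (M - i) *
        (Real.exp (-1 * y) * y ^ i)).intervalIntegrable u v]
  refine Finset.sum_congr rfl fun i _ => ?_
  rw [intervalIntegral.integral_const_mul]
  congr 1
  rw [intervalIntegral.integral_eq_sub_of_hasDerivAt (f := fun y => -gammaTail 1 i y)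
    (fun y _ => hasDerivAt_neg_gammaTail one_ne_zero i y)
    ((by fun_prop : Continuous fun y : ℝ => Real.exp (-1 * y) * y ^ i).intervalIntegrable u v)]
  ring

/-- The integrand in `z`, for the indices `i` and `l`, that an endpoint `x` of the inner
integral contributes. -/
noncomputable def endTerm (M : ℕ) (z x : ℝ) (i l : ℕ) : ℝ :=
  Real.exp (-z) * z ^ (M - i) * (Real.exp (-x) * x ^ l / (l ! : ℝ))

lemma xi_congr {N p : ℕ} {f g : ℕ → ℕ → ℝ} (h : ∀ i l, i ≤ N - 2 → f i l = g i l) :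
    xi N p f = xi N p g := by
  unfold xi
  congr 1
  refine Finset.sum_congr rfl fun t _ => ?_
  congr 1
  refine Finset.sum_congr rfl fun i hi => ?_
  congr 1
  exact Finset.sum_congr rfl fun l _ => h i l (by simp at hi; omega)

/-- The contribution of the `p`-th cone at interference level `z`. -/
lemma mul_intervalIntegral_eq_xi (M p : ℕ) (z u v : ℝ) :
    ((M + 2 : ℕ) : ℝ) * (Real.exp (-z) * ∫ y in u..v, Real.exp (-y) * (((M ! : ℝ))⁻¹ *
      ∑ t ∈ Finset.range p, ((M + 1).choose t : ℝ) * (-1) ^ t * (z - t * y) ^ M)) =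
    xi (M + 2) p (fun i l => endTerm M z u i l - endTerm M z v i l) := by
  have h1 : ∀ y : ℝ, Real.exp (-y) * (((M ! : ℝ))⁻¹ *
      ∑ t ∈ Finset.range p, ((M + 1).choose t : ℝ) * (-1) ^ t * (z - t * y) ^ M) =
      ((M ! : ℝ))⁻¹ * ∑ t ∈ Finset.range p, ((M + 1).choose t : ℝ) * (-1) ^ t *
        (Real.exp (-y) * (z - t * y) ^ M) := by
    intro y
    rw [mul_left_comm, Finset.mul_sum]
    congr 1
    refine Finset.sum_congr rfl fun t _ => ?_
    ring
  simp_rw [h1]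
  rw [intervalIntegral.integral_const_mul, intervalIntegral.integral_finsetSum fun t _ =>
    (by fun_prop : Continuous fun y : ℝ => ((M + 1).choose t : ℝ) * (-1) ^ t *
        (Real.exp (-y) * (z - t * y) ^ M)).intervalIntegrable u v]
  simp_rw [intervalIntegral.integral_const_mul, intervalIntegral_exp_mul_sub_pow]
  unfold xi
  rw [← Finset.Ico_add_one_right_eq_Icc, Finset.sum_Ico_eq_sum_range]
  simp only [Nat.add_sub_cancel, Nat.add_sub_cancel_left, div_eq_mul_inv]
  rw [mul_left_comm (Real.exp (-z)), ← mul_assoc, Finset.mul_sum]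
  congr 1
  refine Finset.sum_congr rfl fun t _ => ?_
  rw [show M + 2 - 1 = M + 1 from rfl, mul_left_comm]
  have h2 : (-1 : ℝ) ^ (1 + t + 1) = (-1) ^ t := by rw [pow_add, pow_add]; norm_num
  have h3 : (1 : ℝ) - ((1 + t : ℕ) : ℝ) = -(t : ℝ) := by push_cast; ring
  rw [h2, h3]
  congr 1
  rw [Finset.mul_sum]
  refine Finset.sum_congr rfl fun i _ => ?_
  unfold gammaTail endTerm
  simp only [Finset.sum_sub_distrib, ← Finset.mul_sum, one_pow, div_one, one_mul, mul_div_assoc,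
    neg_mul]
  ring

lemma integrable_xi {N p : ℕ} {μ : Measure ℝ} {f : ℝ → ℕ → ℕ → ℝ}
    (hf : ∀ i l, Integrable (fun z => f z i l) μ) : Integrable (fun z => xi N p (f z)) μ := by
  unfold xi
  exact (integrable_finsetSum _ fun t _ => (integrable_finsetSum _ fun i _ =>
    (integrable_finsetSum _ fun l _ => hf i l).const_mul _).const_mul _).const_mul _

lemma integral_xi {N p : ℕ} {μ : Measure ℝ} {f : ℝ → ℕ → ℕ → ℝ}
    (hf : ∀ i l, Integrable (fun z => f z i l) μ) :
    ∫ z, xi N p (fun i l => f z i l) ∂μ = xi N p (fun i l => ∫ z, f z i l ∂μ) := by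
  unfold xi
  rw [integral_const_mul, integral_finsetSum _ fun t _ => (integrable_finsetSum _ fun i _ =>
    (integrable_finsetSum _ fun l _ => hf i l).const_mul _).const_mul _]
  congr 1
  refine Finset.sum_congr rfl fun t _ => ?_
  rw [integral_const_mul, integral_finsetSum _ fun i _ =>
    (integrable_finsetSum _ fun l _ => hf i l).const_mul _]
  congr 1
  refine Finset.sum_congr rfl fun i _ => ?_
  rw [integral_const_mul, integral_finsetSum _ fun l _ => hf i l]

lemma integral_xi_sub {N p : ℕ} {μ : Measure ℝ} {f g : ℝ → ℕ → ℕ → ℝ}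
    (hf : ∀ i l, Integrable (fun z => f z i l) μ) (hg : ∀ i l, Integrable (fun z => g z i l) μ) :
    ∫ z, xi N p (fun i l => f z i l - g z i l) ∂μ =
      xi N p (fun i l => (∫ z, f z i l ∂μ) - ∫ z, g z i l ∂μ) := by
  refine (integral_xi (f := fun z i l => f z i l - g z i l)
    fun i l => (hf i l).sub (hg i l)).trans ?_
  exact congrArg _ (funext₂ fun i l => integral_sub (hf i l) (hg i l))

lemma endTerm_div (M : ℕ) {r κ : ℝ} (hκ : κ = 1 + 1 / r) (z : ℝ) (i l : ℕ) :
    endTerm M z (z / r) i l =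
      1 / (r ^ l * (l ! : ℝ)) * (Real.exp (-κ * z) * z ^ (M - i + l)) := by
  have h1 : Real.exp (-κ * z) = Real.exp (-z) * Real.exp (-(z / r)) := by
    rw [← Real.exp_add, hκ]; congr 1; ring
  rw [endTerm, h1, pow_add, div_pow]
  ring

lemma endTerm_affine (M : ℕ) (T c z : ℝ) (i l : ℕ) :
    endTerm M z (T * (c + z)) i l = Real.exp (-(T * c)) * (T ^ l / (l ! : ℝ)) *
      ∑ v ∈ Finset.range (l + 1), (l.choose v : ℝ) * c ^ (l - v) *
        (Real.exp (-(T + 1) * z) * z ^ (M - i + v)) := by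
  have h1 : Real.exp (-(T + 1) * z) * Real.exp (-(T * c)) =
      Real.exp (-z) * Real.exp (-(T * (c + z))) := by
    rw [← Real.exp_add, ← Real.exp_add]; congr 1; ring
  have h2 : ∑ v ∈ Finset.range (l + 1), (l.choose v : ℝ) * c ^ (l - v) *
        (Real.exp (-(T + 1) * z) * z ^ (M - i + v)) =
      Real.exp (-(T + 1) * z) * z ^ (M - i) * (c + z) ^ l := by
    rw [add_comm c z, add_pow, Finset.mul_sum]
    refine Finset.sum_congr rfl fun v _ => ?_
    rw [pow_add]
    ring
  rw [h2, endTerm, mul_pow]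
  linear_combination (-z ^ (M - i) * T ^ l * (c + z) ^ l / (l ! : ℝ)) * h1

lemma integrableOn_endTerm_div (M : ℕ) {r : ℝ} (hr : 0 < r) {u : ℝ} (hu : 0 ≤ u) (i l : ℕ) :
    IntegrableOn (fun z => endTerm M z (z / r) i l) (Set.Ioi u) := by
  simp_rw [endTerm_div M (rfl : 1 + 1 / r = 1 + 1 / r)]
  exact (integrableOn_exp_mul_pow (by positivity) _ hu).const_mul _

lemma setIntegral_endTerm_div (M : ℕ) {r κ : ℝ} (hr : 0 < r) (hκ : κ = 1 + 1 / r) {u : ℝ}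
    (hu : 0 ≤ u) (i l : ℕ) :
    ∫ z in Set.Ioi u, endTerm M z (z / r) i l =
      1 / (r ^ l * (l ! : ℝ)) * gammaTail κ (M - i + l) u := by
  have : 0 < κ := by rw [hκ]; positivity
  simp_rw [endTerm_div M hκ]
  rw [integral_const_mul, setIntegral_Ioi_exp_mul_pow this _ hu]

lemma integrableOn_endTerm_affine (M : ℕ) {T : ℝ} (hT : 0 < T) (c : ℝ) {u : ℝ} (hu : 0 ≤ u)
    (i l : ℕ) : IntegrableOn (fun z => endTerm M z (T * (c + z)) i l) (Set.Ioi u) := by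
  simp_rw [endTerm_affine]
  exact (integrable_finsetSum _ fun v _ =>
    (integrableOn_exp_mul_pow (by positivity) _ hu).const_mul _).const_mul _

lemma setIntegral_endTerm_affine (M : ℕ) {T : ℝ} (hT : 0 < T) (c : ℝ) {u : ℝ} (hu : 0 ≤ u)
    (i l : ℕ) :
    ∫ z in Set.Ioi u, endTerm M z (T * (c + z)) i l =
      Real.exp (-(T * c)) * (T ^ l / (l ! : ℝ)) * ∑ v ∈ Finset.range (l + 1),
        (l.choose v : ℝ) * c ^ (l - v) * gammaTail (T + 1) (M - i + v) u := by
  simp_rw [endTerm_affine]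
  rw [integral_const_mul, integral_finsetSum _ fun v _ =>
    (integrableOn_exp_mul_pow (by positivity) _ hu).const_mul _]
  congr 1
  refine Finset.sum_congr rfl fun v _ => ?_
  rw [integral_const_mul, setIntegral_Ioi_exp_mul_pow (by positivity) _ hu]

lemma setIntegral_Ioc_eq_sub {f : ℝ → ℝ} {u v : ℝ} (huv : u ≤ v)
    (hf : IntegrableOn f (Set.Ioi u)) :
    ∫ z in Set.Ioc u v, f z = (∫ z in Set.Ioi u, f z) - ∫ z in Set.Ioi v, f z := by
  rw [intervalIntegral.integral_Ioi_sub_Ioi hf huv, intervalIntegral.integral_of_le huv]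

/-! ### The closed form below threshold one -/

/-- `bpt N ρ T k` is where the line `y = T (N / ρ + z)` crosses the ray `y = z / k`. -/
lemma bpt_iff {N : ℕ} {ρ T : ℝ} {k : ℕ} (hTk : T < 1 / k) (z : ℝ) :
    z ≤ bpt N ρ T k ↔ z / k ≤ T * (N / ρ + z) := by
  have h1 : 0 < 1 / (k : ℝ) - T := sub_pos.2 hTk
  rw [bpt, ← div_div, le_div_iff₀ h1, mul_sub, mul_one_div, mul_add, sub_le_iff_le_add,
    mul_div_assoc, mul_comm z T]

lemma bpt_nonneg {N : ℕ} {ρ T : ℝ} (hρ : 0 < ρ) (hT : 0 < T) {k : ℕ} (hTk : T < 1 / k) :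
    0 ≤ bpt N ρ T k := by
  have h1 : 0 < 1 / (k : ℝ) - T := sub_pos.2 hTk
  unfold bpt
  positivity

/-- A function given by three formulas on `(0, u]`, `(u, v]` and `(v, ∞)`, the first being `0`. -/
lemma setIntegral_Ioi_piecewise {f g h : ℝ → ℝ} {u v : ℝ} (hu : 0 ≤ u) (huv : u ≤ v)
    (h0 : ∀ z ∈ Set.Ioc 0 u, f z = 0) (h1 : ∀ z ∈ Set.Ioc u v, f z = g z)
    (h2 : ∀ z ∈ Set.Ioi v, f z = h z) (hg : IntegrableOn g (Set.Ioi u))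
    (hh : IntegrableOn h (Set.Ioi v)) :
    IntegrableOn f (Set.Ioi 0) ∧
      ∫ z in Set.Ioi 0, f z = (∫ z in Set.Ioc u v, g z) + ∫ z in Set.Ioi v, h z := by
  have i0 : IntegrableOn f (Set.Ioc 0 u) :=
    (integrableOn_zero (ε' := ℝ)).congr_fun (fun z hz => (h0 z hz).symm) measurableSet_Ioc
  have i1 : IntegrableOn f (Set.Ioc u v) :=
    (hg.mono_set Set.Ioc_subset_Ioi_self).congr_fun (fun z hz => (h1 z hz).symm) measurableSet_Ioc
  have i2 : IntegrableOn f (Set.Ioi v) :=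
    hh.congr_fun (fun z hz => (h2 z hz).symm) measurableSet_Ioi
  have i3 : IntegrableOn f (Set.Ioi u) := by
    rw [← Set.Ioc_union_Ioi_eq_Ioi huv]; exact i1.union i2
  have i4 : IntegrableOn f (Set.Ioi 0) := by
    rw [← Set.Ioc_union_Ioi_eq_Ioi hu]; exact i0.union i3
  refine ⟨i4, ?_⟩
  have e0 := setIntegral_Ioc_eq_sub hu i4
  have e1 := setIntegral_Ioc_eq_sub huv i3
  rw [setIntegral_eq_zero_of_forall_eq_zero h0] at e0
  rw [setIntegral_congr_fun measurableSet_Ioc h1] at e1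
  rw [← setIntegral_congr_fun measurableSet_Ioi h2]
  linarith

lemma D1_eq {M : ℕ} (ρ T : ℝ) (k : ℕ) {i : ℕ} (l : ℕ) (hi : i ≤ M) :
    D1 (M + 2) ρ T k i l = ∑ v ∈ Finset.range (l + 1), (l.choose v : ℝ) *
      (((M + 2 : ℕ) : ℝ) / ρ) ^ (l - v) * (gammaTail (T + 1) (M - i + v) (bpt (M + 2) ρ T (k - 1)) -
        gammaTail (T + 1) (M - i + v) (bpt (M + 2) ρ T k)) := by
  unfold D1
  refine Finset.sum_congr rfl fun v _ => ?_
  rw [show M + 2 - i + v - 2 = M - i + v by omega, show M + 2 - i + v - 1 = M - i + v + 1 by omega,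
    mul_assoc]
  congr 1
  simp only [gammaTail, mul_assoc, Finset.mul_sum, ← Finset.sum_sub_distrib]
  refine Finset.sum_congr rfl fun u _ => ?_
  ring

lemma D2_eq {M : ℕ} (ρ T : ℝ) (k : ℕ) {i : ℕ} (l : ℕ) (hi : i ≤ M) :
    D2 (M + 2) ρ T k i l =
      gammaTail ((k : ℝ) / (k - 1)) (M - i + l) (bpt (M + 2) ρ T (k - 1)) -
        gammaTail ((k : ℝ) / (k - 1)) (M - i + l) (bpt (M + 2) ρ T k) := by
  unfold D2 gammaTail
  rw [show M + 2 - i + l - 2 = M - i + l by omega, show M + 2 - i + l - 1 = M - i + l + 1 by omega]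
  ring

lemma E1_eq {M : ℕ} (ρ T : ℝ) (k : ℕ) {i : ℕ} (l : ℕ) (hi : i ≤ M) :
    E1 (M + 2) ρ T k i l =
      gammaTail (((k : ℝ) + 1) / k) (M - i + l) (bpt (M + 2) ρ T k) := by
  unfold E1 gammaTail
  rw [show M + 2 - i + l - 2 = M - i + l by omega, show M + 2 - i + l - 1 = M - i + l + 1 by omega]

lemma E2_eq {M : ℕ} (ρ T : ℝ) (k : ℕ) {i : ℕ} (l : ℕ) (hi : i ≤ M) :
    E2 (M + 2) ρ T k i l =
      gammaTail ((k : ℝ) / (k - 1)) (M - i + l) (bpt (M + 2) ρ T k) := by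
  unfold E2 gammaTail
  rw [show M + 2 - i + l - 2 = M - i + l by omega, show M + 2 - i + l - 1 = M - i + l + 1 by omega]

lemma F1_eq {M : ℕ} (ρ T : ℝ) (m : ℕ) {i : ℕ} (l : ℕ) (hi : i ≤ M) :
    F1 (M + 2) ρ T m i l = ∑ v ∈ Finset.range (l + 1), (l.choose v : ℝ) *
      (((M + 2 : ℕ) : ℝ) / ρ) ^ (l - v) *
        gammaTail (T + 1) (M - i + v) (bpt (M + 2) ρ T (m - 1)) := by
  unfold F1 gammaTail
  refine Finset.sum_congr rfl fun v _ => ?_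
  rw [show M + 2 - i + v - 2 = M - i + v by omega, show M + 2 - i + v - 1 = M - i + v + 1 by omega]
  ring

lemma F2_eq {M : ℕ} (ρ T : ℝ) (m : ℕ) {i : ℕ} (l : ℕ) (hi : i ≤ M) :
    F2 (M + 2) ρ T m i l =
      gammaTail ((m : ℝ) / (m - 1)) (M - i + l) (bpt (M + 2) ρ T (m - 1)) := by
  unfold F2 gammaTail
  rw [show M + 2 - i + l - 2 = M - i + l by omega, show M + 2 - i + l - 1 = M - i + l + 1 by omega]

/-- The part `z < y` of the region, with lower boundary `y = T (c + z)` up to `b_1`, and `y = z`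
from there on. -/
lemma setIntegral_first (M : ℕ) {ρ T : ℝ} (hρ : 0 < ρ) (hT : 0 < T) (hT1 : T < 1) :
    IntegrableOn (fun z => ((M + 2 : ℕ) : ℝ) * (Real.exp (-z) *
        ∫ y in Set.Ioi (max (T * (((M + 2 : ℕ) : ℝ) / ρ + z)) z),
          Real.exp (-y) * (((M ! : ℝ))⁻¹ * z ^ M))) (Set.Ioi 0) ∧
      ∫ z in Set.Ioi 0, ((M + 2 : ℕ) : ℝ) * (Real.exp (-z) *
        ∫ y in Set.Ioi (max (T * (((M + 2 : ℕ) : ℝ) / ρ + z)) z),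
          Real.exp (-y) * (((M ! : ℝ))⁻¹ * z ^ M)) = Pfirst (M + 2) ρ T := by
  have hT1' : T < 1 / ((1 : ℕ) : ℝ) := by simpa using hT1
  have hb := bpt_iff (N := M + 2) (ρ := ρ) hT1'
  have hb0 := bpt_nonneg (N := M + 2) hρ hT hT1'
  set b := bpt (M + 2) ρ T 1 with hbdef
  set c := ((M + 2 : ℕ) : ℝ) / ρ with hc
  simp only [Nat.cast_one, div_one] at hb
  have hK : (0 : ℝ) < T + 1 := by positivity
  have hmain := setIntegral_Ioi_piecewise (u := 0) (v := b)
    (f := fun z => ((M + 2 : ℕ) : ℝ) * (Real.exp (-z) *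
        ∫ y in Set.Ioi (max (T * (c + z)) z), Real.exp (-y) * (((M ! : ℝ))⁻¹ * z ^ M)))
    (g := fun z => ((M + 2 : ℕ) : ℝ) * ((M ! : ℝ))⁻¹ * Real.exp (-(T * c)) *
      (Real.exp (-(T + 1) * z) * z ^ M))
    (h := fun z => ((M + 2 : ℕ) : ℝ) * ((M ! : ℝ))⁻¹ * (Real.exp (-2 * z) * z ^ M))
    le_rfl hb0 (by simp)
    (fun z hz => by
      rw [integral_mul_const, integral_exp_neg_Ioi, max_eq_left ((hb z).1 hz.2)]
      have : Real.exp (-z) * Real.exp (-(T * (c + z))) =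
          Real.exp (-(T * c)) * Real.exp (-(T + 1) * z) := by
        rw [← Real.exp_add, ← Real.exp_add]; congr 1; ring
      linear_combination ((M + 2 : ℕ) : ℝ) * ((M ! : ℝ))⁻¹ * z ^ M * this)
    (fun z hz => by
      have h1 : T * (c + z) ≤ z := (not_le.1 (fun h => not_le.2 hz ((hb z).2 h))).le
      rw [integral_mul_const, integral_exp_neg_Ioi, max_eq_right h1]
      have : Real.exp (-z) * Real.exp (-z) = Real.exp (-2 * z) := by
        rw [← Real.exp_add]; congr 1; ring
      linear_combination ((M + 2 : ℕ) : ℝ) * ((M ! : ℝ))⁻¹ * z ^ M * this)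
    ((integrableOn_exp_mul_pow hK M le_rfl).const_mul _)
    ((integrableOn_exp_mul_pow two_pos M hb0).const_mul _)
  refine ⟨hmain.1, hmain.2.trans ?_⟩
  rw [integral_const_mul, integral_const_mul, setIntegral_Ioc_eq_sub hb0
    (integrableOn_exp_mul_pow hK M le_rfl), setIntegral_Ioi_exp_mul_pow hK M le_rfl,
    setIntegral_Ioi_exp_mul_pow hK M hb0, setIntegral_Ioi_exp_mul_pow two_pos M hb0, gammaTail_zero]
  unfold Pfirst C1 C2 gammaTail
  rw [← hbdef, hc, mul_div_assoc]
  simp only [Nat.add_sub_cancel, show M + 2 - 1 = M + 1 from rfl, mul_div_assoc]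
  ring

/-- The contribution of the interference level `z` and of the powers `y > T (c + z)` with
`z / p < y ≤ z / (p - 1)`; clamping the two endpoints to `T (c + z)` makes it vanish when
there is no such `y`. -/
noncomputable def coneTerm (M : ℕ) (T c : ℝ) (p : ℕ) (z : ℝ) : ℝ :=
  xi (M + 2) p (fun i l => endTerm M z (max (T * (c + z)) (z / (p : ℝ))) i l -
    endTerm M z (max (T * (c + z)) (z / ((p : ℝ) - 1))) i l)

lemma xi_zero (N p : ℕ) : xi N p (fun _ _ => 0) = 0 := by simp [xi]

/-- The part `z / (j + 1) < y ≤ z / j` of the region, when the line `y = T (c + z)` crosses both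
bounding rays: it enters the cone at `z = b_j` and leaves it at `z = b_{j + 1}`. -/
lemma setIntegral_mid (M : ℕ) {ρ T : ℝ} (hρ : 0 < ρ) (hT : 0 < T) {j : ℕ} (hj : 1 ≤ j)
    (hTj : T < 1 / ((j + 1 : ℕ) : ℝ)) :
    IntegrableOn (coneTerm M T (((M + 2 : ℕ) : ℝ) / ρ) (j + 1)) (Set.Ioi 0) ∧
      ∫ z in Set.Ioi 0, coneTerm M T (((M + 2 : ℕ) : ℝ) / ρ) (j + 1) z =
      Pmid (M + 2) ρ T (j + 1) := by
  have hj0 : (0 : ℝ) < j := by exact_mod_cast hj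
  have hjj : ((j + 1 : ℕ) : ℝ) - 1 = j := by push_cast; ring
  have hj1 : (0 : ℝ) < ((j + 1 : ℕ) : ℝ) := by positivity
  have hjle : (j : ℝ) ≤ ((j + 1 : ℕ) : ℝ) := by push_cast; linarith
  have hTj' : T < 1 / (j : ℝ) := hTj.trans_le (one_div_le_one_div_of_le hj0 hjle)
  have hb := bpt_iff (N := M + 2) (ρ := ρ) hTj'
  have hb' := bpt_iff (N := M + 2) (ρ := ρ) hTj
  have hu := bpt_nonneg (N := M + 2) hρ hT hTj'
  set u := bpt (M + 2) ρ T j with hudef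
  set v := bpt (M + 2) ρ T (j + 1) with hvdef
  set c := ((M + 2 : ℕ) : ℝ) / ρ with hc
  have hdiv : ∀ z : ℝ, 0 ≤ z → z / ((j + 1 : ℕ) : ℝ) ≤ z / j := fun z hz =>
    div_le_div_of_nonneg_left hz hj0 hjle
  have huv : u ≤ v := (hb' u).2 ((hdiv u hu).trans ((hb u).1 le_rfl))
  have hv := hu.trans huv
  have gt_of : ∀ z, u < z → T * (c + z) ≤ z / j := fun z hz =>
    (not_le.1 (fun h => not_le.2 hz ((hb z).2 h))).le
  have gt_of' : ∀ z, v < z → T * (c + z) ≤ z / ((j + 1 : ℕ) : ℝ) := fun z hz =>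
    (not_le.1 (fun h => not_le.2 hz ((hb' z).2 h))).le
  have iA : ∀ (w : ℝ), 0 ≤ w → ∀ i l, IntegrableOn (fun z => endTerm M z (T * (c + z)) i l)
    (Set.Ioi w) := fun w hw i l => integrableOn_endTerm_affine M hT c hw i l
  have iJ : ∀ (w : ℝ), 0 ≤ w → ∀ i l, IntegrableOn (fun z => endTerm M z (z / j) i l)
    (Set.Ioi w) := fun w hw i l => integrableOn_endTerm_div M hj0 hw i l
  have iK : ∀ (w : ℝ), 0 ≤ w → ∀ i l,
    IntegrableOn (fun z => endTerm M z (z / ((j + 1 : ℕ) : ℝ)) i l)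
    (Set.Ioi w) := fun w hw i l => integrableOn_endTerm_div M hj1 hw i l
  have hmain := setIntegral_Ioi_piecewise (u := u) (v := v)
    (f := coneTerm M T c (j + 1))
    (g := fun z => xi (M + 2) (j + 1) (fun i l =>
        endTerm M z (T * (c + z)) i l - endTerm M z (z / (j : ℝ)) i l))
    (h := fun z => xi (M + 2) (j + 1) (fun i l =>
        endTerm M z (z / ((j + 1 : ℕ) : ℝ)) i l - endTerm M z (z / (j : ℝ)) i l))
    hu huv
    (fun z hz => by
      have h1 := (hb z).1 hz.2
      simp only [coneTerm, hjj, max_eq_left h1, max_eq_left ((hdiv z hz.1.le).trans h1), sub_self,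
        xi_zero])
    (fun z hz => by
      simp only [coneTerm, hjj, max_eq_left ((hb' z).1 hz.2), max_eq_right (gt_of z hz.1)])
    (fun z hz => by
      simp only [coneTerm, hjj, max_eq_right (gt_of' z hz),
        max_eq_right (gt_of z (huv.trans_lt hz))])
    (integrable_xi fun i l => (iA u hu i l).sub (iJ u hu i l))
    (integrable_xi fun i l => (iK v hv i l).sub (iJ v hv i l))
  refine ⟨hmain.1, hmain.2.trans ?_⟩
  rw [integral_xi_sub (iK v hv) (iJ v hv),
    integral_xi_sub (fun i l => (iA u hu i l).mono_set Set.Ioc_subset_Ioi_self)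
      fun i l => (iJ u hu i l).mono_set Set.Ioc_subset_Ioi_self]
  have hκ : ((j + 1 : ℕ) : ℝ) / j = 1 + 1 / j := by push_cast; field_simp
  have hκ' : (((j + 1 : ℕ) : ℝ) + 1) / ((j + 1 : ℕ) : ℝ) = 1 + 1 / ((j + 1 : ℕ) : ℝ) := by
    field_simp
  unfold Pmid
  congr 1
  · refine xi_congr fun i l (hi : i ≤ M) => ?_
    rw [D1_eq ρ T _ l hi, D2_eq ρ T _ l hi, hjj, Nat.add_sub_cancel, ← hudef, ← hvdef, ← hc,
      mul_div_assoc, ← hc,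
      setIntegral_Ioc_eq_sub huv (iA u hu i l), setIntegral_Ioc_eq_sub huv (iJ u hu i l),
      setIntegral_endTerm_affine M hT c hu, setIntegral_endTerm_affine M hT c hv,
      setIntegral_endTerm_div M hj0 hκ hu, setIntegral_endTerm_div M hj0 hκ hv]
    simp only [mul_sub, Finset.sum_sub_distrib]
  · refine xi_congr fun i l (hi : i ≤ M) => ?_
    rw [E1_eq ρ T _ l hi, E2_eq ρ T _ l hi, hjj, ← hvdef,
      setIntegral_endTerm_div M hj0 hκ hv, setIntegral_endTerm_div M hj1 hκ' hv]

/-- The last cone that meets the region: there `y = T (c + z)` never drops below `z / (j + 1)`. -/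
lemma setIntegral_last (M : ℕ) {ρ T : ℝ} (hρ : 0 < ρ) (hT : 0 < T) {j : ℕ} (hj : 1 ≤ j)
    (hTj : T < 1 / (j : ℝ)) (hTj1 : 1 / ((j + 1 : ℕ) : ℝ) ≤ T) :
    IntegrableOn (coneTerm M T (((M + 2 : ℕ) : ℝ) / ρ) (j + 1)) (Set.Ioi 0) ∧
      ∫ z in Set.Ioi 0, coneTerm M T (((M + 2 : ℕ) : ℝ) / ρ) (j + 1) z =
      Plast (M + 2) ρ T (j + 1) := by
  have hj0 : (0 : ℝ) < j := by exact_mod_cast hj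
  have hjj : ((j + 1 : ℕ) : ℝ) - 1 = j := by push_cast; ring
  have hb := bpt_iff (N := M + 2) (ρ := ρ) hTj
  have hu := bpt_nonneg (N := M + 2) hρ hT hTj
  set u := bpt (M + 2) ρ T j with hudef
  set c := ((M + 2 : ℕ) : ℝ) / ρ with hc
  have hc0 : 0 < c := by positivity
  have hlow : ∀ z : ℝ, 0 ≤ z → z / ((j + 1 : ℕ) : ℝ) ≤ T * (c + z) := by
    intro z hz
    have h1 := mul_le_mul_of_nonneg_right hTj1 hz
    rw [one_div_mul_eq_div] at h1
    nlinarith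
  have gt_of : ∀ z, u < z → T * (c + z) ≤ z / j := fun z hz =>
    (not_le.1 (fun h => not_le.2 hz ((hb z).2 h))).le
  have iA := integrableOn_endTerm_affine M hT c hu
  have iJ := integrableOn_endTerm_div M hj0 hu
  have hmain := setIntegral_Ioi_piecewise (u := u) (v := u)
    (f := coneTerm M T c (j + 1))
    (g := fun _ => 0)
    (h := fun z => xi (M + 2) (j + 1) (fun i l =>
        endTerm M z (T * (c + z)) i l - endTerm M z (z / (j : ℝ)) i l))
    hu le_rfl
    (fun z hz => by
      simp only [coneTerm, hjj, max_eq_left ((hb z).1 hz.2), max_eq_left (hlow z hz.1.le),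
        sub_self, xi_zero])
    (by simp)
    (fun z hz => by
      simp only [coneTerm, hjj, max_eq_left (hlow z (hu.trans hz.le)), max_eq_right (gt_of z hz)])
    integrableOn_zero
    (integrable_xi fun i l => (iA i l).sub (iJ i l))
  refine ⟨hmain.1, hmain.2.trans ?_⟩
  rw [Set.Ioc_self, setIntegral_empty, zero_add, integral_xi_sub iA iJ]
  have hκ : ((j + 1 : ℕ) : ℝ) / j = 1 + 1 / j := by push_cast; field_simp
  unfold Plast
  refine xi_congr fun i l (hi : i ≤ M) => ?_
  rw [F1_eq ρ T _ l hi, F2_eq ρ T _ l hi, hjj, Nat.add_sub_cancel, ← hudef, mul_div_assoc, ← hc,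
    setIntegral_endTerm_affine M hT c hu,
    setIntegral_endTerm_div M hj0 hκ hu]

/-- For `T < 1`, the probability that the strongest beam is covered. -/
lemma real_covered_of_lt_one (M : ℕ) {ρ T : ℝ} (hρ : 0 < ρ) (hT : 0 < T) (hT1 : T < 1) :
    ((M + 2 : ℕ) : ℝ) * ((expMeasure 1).prod
      (Measure.pi fun _ : Fin (M + 1) => expMeasure 1)).real
      {p | T * (((M + 2 : ℕ) : ℝ) / ρ + ∑ i, p.2 i) < p.1 ∧ ∀ i, p.2 i < p.1} =
    Pfirst (M + 2) ρ T + ∑ k ∈ Finset.Icc 2 (mIdx T - 1), Pmid (M + 2) ρ T k +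
      Plast (M + 2) ρ T (mIdx T) := by
  have hm2 : 1 < mIdx T := Nat.lt_ceil.2 (by rw [Nat.cast_one, lt_div_iff₀ hT]; linarith)
  obtain ⟨j, hj⟩ : ∃ j, mIdx T = j + 1 := ⟨mIdx T - 1, by omega⟩
  have hlt : ∀ k : ℕ, 1 ≤ k → k ≤ j → T < 1 / (k : ℝ) := by
    intro k hk hkj
    have hk0 : (0 : ℝ) < k := by exact_mod_cast hk
    have h1 : (k : ℝ) < 1 / T := Nat.lt_ceil.1 (by unfold mIdx at hj; omega)
    rwa [lt_one_div hT hk0]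
  have hlast : 1 / ((j + 1 : ℕ) : ℝ) ≤ T := by
    have h1 : 1 / T ≤ ((j + 1 : ℕ) : ℝ) := by rw [← hj]; exact Nat.le_ceil _
    rwa [one_div_le (by positivity) hT]
  set c := ((M + 2 : ℕ) : ℝ) / ρ with hc
  have hc0 : 0 < c := by positivity
  rw [real_covered_eq_integral M hc0 hT, ← integral_const_mul]
  have hsplit : ∀ z ∈ Set.Ioi (0 : ℝ), ((M + 2 : ℕ) : ℝ) * (Real.exp (-z) *
      ∫ y in Set.Ioi (T * (c + z)), Real.exp (-y) * truncDensity M y z) =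
      ((M + 2 : ℕ) : ℝ) * (Real.exp (-z) *
        ∫ y in Set.Ioi (max (T * (c + z)) z), Real.exp (-y) * (((M ! : ℝ))⁻¹ * z ^ M)) +
      ∑ p ∈ Finset.Icc 2 (j + 1), coneTerm M T c p z := by
    intro z hz
    have hz0 : (0 : ℝ) < z := hz
    have ha : z / ((j + 1 : ℕ) : ℝ) ≤ T * (c + z) := by
      have h1 := mul_le_mul_of_nonneg_right hlast hz0.le
      rw [one_div_mul_eq_div] at h1
      nlinarith
    rw [integral_truncDensity_split M (Nat.le_add_left 1 j) hz0 ha, mul_add, mul_add,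
      Finset.mul_sum, Finset.mul_sum]
    congr 1
    exact Finset.sum_congr rfl fun p _ => mul_intervalIntegral_eq_xi M p z _ _
  rw [setIntegral_congr_fun measurableSet_Ioi hsplit]
  have hP1 := setIntegral_first M hρ hT hT1
  have hPl := setIntegral_last M hρ hT (j := j) (by omega) (hlt j (by omega) le_rfl) hlast
  have hPm : ∀ p ∈ Finset.Icc 2 j, IntegrableOn (coneTerm M T c p) (Set.Ioi 0) ∧
      ∫ z in Set.Ioi 0, coneTerm M T c p z = Pmid (M + 2) ρ T p := by
    intro p hp
    obtain ⟨h2, hpj⟩ := Finset.mem_Icc.1 hp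
    obtain ⟨q, rfl⟩ : ∃ q, p = q + 1 := ⟨p - 1, by omega⟩
    exact setIntegral_mid M hρ hT (j := q) (by omega) (hlt (q + 1) (by omega) hpj)
  rw [← hc] at hP1 hPl
  have hsum := integrable_finsetSum (Finset.Icc 2 j) fun p hp => (hPm p hp).1
  simp_rw [Finset.sum_Icc_succ_top (by omega : 2 ≤ j + 1)]
  have hrest : IntegrableOn (fun z => ∑ p ∈ Finset.Icc 2 j, coneTerm M T c p z +
      coneTerm M T c (j + 1) z) (Set.Ioi 0) := hsum.add hPl.1
  rw [integral_add hP1.1 hrest, integral_add hsum hPl.1,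
    integral_finsetSum _ fun p hp => (hPm p hp).1, hP1.2, hPl.2,
    Finset.sum_congr rfl fun p hp => (hPm p hp).2, hj, Nat.add_sub_cancel, add_assoc]

end ORP

theorem theorem1 {Ω : Type*} [MeasurableSpace Ω] (P : Measure Ω) [IsProbabilityMeasure P]
    (Nt N : ℕ) (hN : 1 ≤ N)
    (PT σ2 ρ T : ℝ) (hPT : 0 < PT) (hσ2 : 0 < σ2) (hρ : ρ = PT / σ2) (hT : 0 < T)
    (h : Ω → Fin Nt → ℂ) (Φ : Ω → Fin N → EuclideanSpace ℂ (Fin Nt))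
    (hh : ORP.IsRayleighChannel P h) (hΦ : ORP.IsOrthonormalPrecoder P Φ)
    (hind : IndepFun h Φ P) :
    (1 ≤ T →
      ORP.coverageProb P PT σ2 T h Φ = N / (T + 1) ^ (N - 1) * Real.exp (-(T * N / ρ))) ∧
    (T < 1 → 2 ≤ N →
      ORP.coverageProb P PT σ2 T h Φ =
        ORP.Pfirst N ρ T + ∑ k ∈ Finset.Icc 2 (ORP.mIdx T - 1), ORP.Pmid N ρ T k +
          ORP.Plast N ρ T (ORP.mIdx T)) := by
  have hρ0 : 0 < ρ := by rw [hρ]; positivity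
  rw [ORP.coverageProb_eq P hN hPT hσ2 hh hΦ hind, ← hρ]
  constructor
  · intro hT1
    obtain ⟨M, rfl⟩ : ∃ M, N = M + 1 := ⟨N - 1, by omega⟩
    rw [ORP.real_exists_covered M hT, ORP.real_covered_of_one_le M (by positivity) hT1,
      Nat.add_sub_cancel, ← mul_div_assoc T]
    push_cast
    ring
  · intro hT1 hN2
    obtain ⟨M, rfl⟩ : ∃ M, N = M + 2 := ⟨N - 2, by omega⟩
    rw [ORP.real_exists_covered (M + 1) hT, ← ORP.real_covered_of_lt_one M hρ0 hT hT1]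
    congr 1
    push_cast
    ring
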